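/- The Generalized Balcar–Vopěnka–Monro Theorem. For ordinals $\eta$ and $\alpha$ let $\mathcal P^\alpha(\eta)$ be the iterated power set: $\mathcal P^0(\eta)=\eta$, $\mathcal P^{\beta+1}(\eta)=\mathcal P(\mathcal P^\beta(\eta))$, and $\mathcal P^\beta(\eta)=\bigcup_{\gamma<\beta}\mathcal P^\gamma(\eta)$ for limit $\beta$. A set is called an $\alpha$-set (of ordinals) if it is a subset of $\mathcal P^\alpha(\eta)$ for some ordinal $\eta$. Let $\mathrm{KWP}_\alpha$ be the statement that every set is equipotent with an $\alpha$-set. Let $M$ and $N$ be transitive models of $\mathsf{ZF}$ (sets or proper classes, with the true membership relation) and let $\alpha$ be an ordinal of $M$. Suppose that $M$ and $N$ have the same $\alpha$-sets, that is, $$\{x\in M : M\models \text{``}x\text{ is an }\alpha\text{-set''}\}=\{x\in N : N\models \text{``}x\text{ is an }\alpha\text{-set''}\},$$ where the right-hand side is read as empty if $\alpha\notin N$. If $M\models \mathrm{KWP}_\alpha$, then $M=N$. -/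

import Mathlib

universe u v

namespace SetModel

/-- The relation symbols of the language of set theory: one binary symbol. -/
inductive MemRel : ℕ → Type
  | mem : MemRel 2

/-- The first-order language of set theory. -/
def setLanguage : FirstOrder.Language.{0, 0} :=
  ⟨fun _ => Empty, MemRel⟩

/-! In this section `S` is a structure for the language of set theory, with `x ∈ y` the
interpretation of the membership symbol. All quantifiers range over `S`, so each definition below is
the interpretation in `S` (the relativisation to `S`) of a formula of set theory. -/

section Structure

variable {S : Type v} [Membership S S]

instance instStructure : setLanguage.Structure S where
  funMap := fun f => Empty.elim f
  RelMap := fun r => match r with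
    | MemRel.mem => fun w => w 0 ∈ w 1

/-- `x ⊆ y` -/
def IsSubset (x y : S) : Prop := ∀ z : S, z ∈ x → z ∈ y

/-- `e = ∅` -/
def IsEmptySet (e : S) : Prop := ∀ z : S, ¬ z ∈ e

/-- `p = {a, b}` -/
def IsUPair (p a b : S) : Prop := ∀ z : S, z ∈ p ↔ z = a ∨ z = b

/-- `p = (a, b) = {{a}, {a, b}}` -/
def IsOPair (p a b : S) : Prop :=
  ∃ s t : S, IsUPair s a a ∧ IsUPair t a b ∧ IsUPair p s t

/-- `y = ⋃ x` -/
def IsUnion (y x : S) : Prop := ∀ z : S, z ∈ y ↔ ∃ w : S, w ∈ x ∧ z ∈ w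

/-- `y = 𝒫(x)` -/
def IsPowerset (y x : S) : Prop := ∀ z : S, z ∈ y ↔ IsSubset z x

/-- `y = x ∪ {x}` -/
def IsSucc (y x : S) : Prop := ∀ z : S, z ∈ y ↔ z ∈ x ∨ z = x

/-- `x` is a transitive set -/
def IsTransSet (x : S) : Prop := ∀ y : S, y ∈ x → IsSubset y x

/-- `x` is an ordinal: a transitive set of transitive sets -/
def IsOrd (x : S) : Prop := IsTransSet x ∧ ∀ y : S, y ∈ x → IsTransSet y

/-- `x` is a limit ordinal: a nonzero ordinal that is not a successor -/
def IsLimitOrd (x : S) : Prop := IsOrd x ∧ ¬ IsEmptySet x ∧ ∀ y : S, ¬ IsSucc x y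

/-- `(x, y) ∈ f` -/
def Maps (f x y : S) : Prop := ∃ p : S, p ∈ f ∧ IsOPair p x y

/-- `f` is a bijection from `a` onto `b` -/
def IsBijection (f a b : S) : Prop :=
  (∀ p : S, p ∈ f → ∃ x y : S, x ∈ a ∧ y ∈ b ∧ IsOPair p x y) ∧
  (∀ x : S, x ∈ a → ∃! y : S, Maps f x y) ∧
  (∀ y : S, y ∈ b → ∃! x : S, Maps f x y)

/-- `a` and `b` are equipotent -/
def Equipotent (a b : S) : Prop := ∃ f : S, IsBijection f a b

/-- `f` is the function with domain `α + 1` and `f(β) = 𝒫^β(η)` for all `β ≤ α`, where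
`𝒫^0(η) = η`, `𝒫^(γ+1)(η) = 𝒫(𝒫^γ(η))`, and `𝒫^β(η) = ⋃_{γ<β} 𝒫^γ(η)` for limit `β`. -/
def IsPowerHierarchy (f η α : S) : Prop :=
  (∀ p : S, p ∈ f → ∃ β y : S, (β ∈ α ∨ β = α) ∧ IsOPair p β y) ∧
  (∀ β : S, β ∈ α ∨ β = α → ∃! y : S, Maps f β y) ∧
  (∀ β y : S, Maps f β y →
    (IsEmptySet β → y = η) ∧
    (∀ γ z : S, IsSucc β γ → Maps f γ z → IsPowerset y z) ∧
    (IsLimitOrd β → ∀ w : S, w ∈ y ↔ ∃ γ z : S, γ ∈ β ∧ Maps f γ z ∧ w ∈ z))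

/-- `x` is an `α`-set (of ordinals): `x ⊆ 𝒫^α(η)` for some ordinal `η`. -/
def IsAlphaSet (α x : S) : Prop :=
  ∃ η f y : S, IsOrd η ∧ IsPowerHierarchy f η α ∧ Maps f α y ∧ IsSubset x y

/-- The principle `KWP_α`: every set is equipotent with an `α`-set. -/
def KWP (α : S) : Prop := ∀ a : S, ∃ x : S, IsAlphaSet α x ∧ Equipotent a x

variable (S) in
/-- `S` satisfies the axioms of `ZF`. In the two schemes, the classes `D` and `R` range over
those that are given by a first-order formula of set theory with parameters from `S`. -/
structure SatisfiesZF : Prop where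
  extensionality : ∀ x y : S, (∀ z : S, z ∈ x ↔ z ∈ y) → x = y
  foundation : ∀ x : S, ¬ IsEmptySet x → ∃ y : S, y ∈ x ∧ ∀ z : S, z ∈ x → ¬ z ∈ y
  pairing : ∀ a b : S, ∃ p : S, IsUPair p a b
  union : ∀ x : S, ∃ y : S, IsUnion y x
  powerset : ∀ x : S, ∃ y : S, IsPowerset y x
  infinity : ∃ x : S, (∃ e : S, IsEmptySet e ∧ e ∈ x) ∧
    ∀ y : S, y ∈ x → ∃ s : S, IsSucc s y ∧ s ∈ x
  separation : ∀ D : Set S, (Set.univ : Set S).Definable₁ setLanguage D →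
    ∀ a : S, ∃ b : S, ∀ z : S, z ∈ b ↔ z ∈ a ∧ z ∈ D
  replacement : ∀ R : Set (S × S), (Set.univ : Set S).Definable₂ setLanguage R →
    ∀ a : S, (∀ x : S, x ∈ a → ∃! y : S, (x, y) ∈ R) →
      ∃ b : S, ∀ y : S, y ∈ b ↔ ∃ x : S, x ∈ a ∧ (x, y) ∈ R

end Structure

/-- A class `M` of sets as a structure, with the true membership relation. -/
instance instMembershipClass (M : Set ZFSet.{u}) : Membership M M :=
  ⟨fun y x => (x : ZFSet.{u}) ∈ (y : ZFSet.{u})⟩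

/-- `M` (a set or a proper class) is a transitive model of `ZF`. -/
structure IsTransitiveModelZF (M : Set ZFSet.{u}) : Prop where
  transitive : ∀ x ∈ M, ∀ y : ZFSet.{u}, y ∈ x → y ∈ M
  satisfiesZF : SatisfiesZF M

/-- The collection of the `α`-sets of `M`, that is, of all `x ∈ M` such that
`M ⊨ x is an α-set`. -/
def alphaSets (M : Set ZFSet.{u}) (α : Ordinal.{u}) : Set ZFSet.{u} :=
  {x | ∃ (hα : α.toZFSet ∈ M) (hx : x ∈ M),
    IsAlphaSet (⟨α.toZFSet, hα⟩ : M) (⟨x, hx⟩ : M)}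

end SetModel

/-!
The theorem rests on coding: a set `x` of `M` is determined by a relation on an `α`-set, and
relations on `α`-sets can in turn be coded by `α`-sets, which `M` and `N` share.

*`M ⊆ N`.* Let `T ∈ M` be a transitive set containing `x`. By `KWP_α` there is in `M` a bijection of
`T` with an `α`-set `A`, which carries the membership relation of `T` to a relation `E ⊆ A × A`. If
`E ∈ N`, then `N` recovers `T`, and hence `x`, as the Mostowski collapse of `(A, E)`
(`subset_of_copy`). To see that `E ∈ N` (`relation_mem`), pairs of elements of `𝒫^α(η)` are coded by
elements of `𝒫^α(η')`, with a coding function that lies in both models (`exists_pairing`). The set of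
codes of the elements of `E` is then an `α`-set of `M`, so it is in `N`, and `N` decodes it.

For `α = 0` the code of a pair of ordinals is its position in the lexicographic order (`lexCode`).
For `α > 0` Kuratowski pairs would raise the level in the iterated power set when `α` is a successor.
Instead, the elements of the base `η` are treated as atoms and are shifted hereditarily, by `1` and by
`1 + η`. The two shifts are injective with disjoint ranges and preserve the level, so the union of
the images of `x` and of `y` under them determines `x` and `y` (`flatPair`). The pair is built from
the elements of `x` and `y`, which lie on lower levels, so this works uniformly for all `α > 0`.

*`N ⊆ M`.* By `∈`-induction, let `x ∈ N` with `x ⊆ M`. The rank of `x` is an ordinal of `N`, hence a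
common `α`-set, so `x` is included in a level `B ∈ M` of the von Neumann hierarchy of `M`. By `KWP_α`
there is in `M ⊆ N` a bijection of `B` with an `α`-set. The image of `x` is in `N`, is an `α`-set, and
so is in `M`, which then recovers `x` as the preimage.

All functions above are defined in the universe of sets by recursions that a model can express, and
`exists_recursion` shows that their restrictions to sets of the model are in the model. The
definability that separation and replacement ask for is tracked by the predicate `Dfn`, which is
closed under the logical operations.
-/

namespace SetModel

/-! ### Definable relations -/

section Definability

open FirstOrder

variable {S : Type v} [Membership S S] {n m : ℕ}

/-- `P` is definable in `S` by a first-order formula of set theory with parameters from `S`. -/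
def Dfn (P : (Fin n → S) → Prop) : Prop :=
  (Set.univ : Set S).Definable setLanguage {v | P v}

/-- `f` is given by a term with parameters from `S`. The language has no function symbols, so `f` is
a coordinate function or a constant. -/
def Trm (f : (Fin n → S) → S) : Prop :=
  ∃ t : (setLanguage[[(Set.univ : Set S)]]).Term (Fin n), ∀ v, t.realize v = f v

/-- A definable binary relation. -/
def Dfn₂ (R : S → S → Prop) : Prop := Dfn fun v : Fin 2 → S => R (v 0) (v 1)

theorem Trm.var (i : Fin n) : Trm fun v : Fin n → S => v i := ⟨.var i, fun _ => rfl⟩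

theorem Trm.const (c : S) : Trm fun _ : Fin n → S => c :=
  ⟨(setLanguage.con (⟨c, trivial⟩ : (Set.univ : Set S))).term, fun _ => by simp⟩

theorem Trm.comp {f : (Fin n → S) → S} (hf : Trm f) {g : Fin n → (Fin m → S) → S}
    (hg : ∀ i, Trm (g i)) : Trm fun v => f fun i => g i v := by
  obtain ⟨t, ht⟩ := hf
  choose s hs using hg
  exact ⟨t.subst s, fun v => by rw [Language.Term.realize_subst, ht]; simp only [hs]⟩

/-- A term remains one when a last variable, to be bound by a quantifier, is added. -/
theorem Trm.wk {f : (Fin n → S) → S} (hf : Trm f) :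
    Trm fun v : Fin (n + 1) → S => f fun i => v i.castSucc :=
  hf.comp fun i => .var i.castSucc

theorem Trm.last : Trm fun v : Fin (n + 1) → S => v (Fin.last n) := .var _

theorem Dfn.comp {P : (Fin n → S) → Prop} (hP : Dfn P) {g : Fin n → (Fin m → S) → S}
    (hg : ∀ i, Trm (g i)) : Dfn fun v => P fun i => g i v := by
  obtain ⟨φ, hφ⟩ := hP
  choose s hs using hg
  refine ⟨φ.subst s, ?_⟩
  ext v
  have h := Set.ext_iff.1 hφ fun i => g i v
  simp only [Set.mem_ofPred_eq] at h ⊢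
  rw [h, Language.Formula.Realize, Language.Formula.Realize, Language.BoundedFormula.realize_subst]
  simp only [hs]

theorem Dfn₂.comp {R : S → S → Prop} (hR : Dfn₂ R) {f g : (Fin n → S) → S} (hf : Trm f)
    (hg : Trm g) : Dfn fun v => R (f v) (g v) :=
  Dfn.comp (g := ![f, g]) hR (Fin.forall_fin_two.2 ⟨hf, hg⟩)

theorem Dfn.congr {P Q : (Fin n → S) → Prop} (hP : Dfn P) (h : ∀ v, Q v ↔ P v) : Dfn Q := by
  rwa [show Q = P from funext fun v => propext (h v)]

theorem Dfn.mem {f g : (Fin n → S) → S} (hf : Trm f) (hg : Trm g) :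
    Dfn fun v => f v ∈ g v := by
  obtain ⟨s, hs⟩ := hf
  obtain ⟨t, ht⟩ := hg
  refine ⟨Language.Relations.formula₂
    (Sum.inl MemRel.mem : (setLanguage[[(Set.univ : Set S)]]).Relations 2) s t, ?_⟩
  ext v
  simp only [Set.mem_ofPred_eq, ← hs, ← ht]
  exact (Language.Formula.realize_rel₂
    (L := setLanguage[[(Set.univ : Set S)]]) (M := S) (R := Sum.inl MemRel.mem)).symm

theorem Dfn.eq {f g : (Fin n → S) → S} (hf : Trm f) (hg : Trm g) :
    Dfn fun v => f v = g v := by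
  obtain ⟨s, hs⟩ := hf
  obtain ⟨t, ht⟩ := hg
  refine ⟨s.equal t, ?_⟩
  ext v
  simp [hs, ht]

theorem Dfn.and {P Q : (Fin n → S) → Prop} (hP : Dfn P) (hQ : Dfn Q) :
    Dfn fun v => P v ∧ Q v := Set.Definable.inter hP hQ

theorem Dfn.or {P Q : (Fin n → S) → Prop} (hP : Dfn P) (hQ : Dfn Q) :
    Dfn fun v => P v ∨ Q v := Set.Definable.union hP hQ

theorem Dfn.not {P : (Fin n → S) → Prop} (hP : Dfn P) : Dfn fun v => ¬ P v :=
  Set.Definable.compl hP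

theorem Dfn.false : Dfn fun _ : Fin n → S => False := Set.definable_empty

theorem Dfn.imp {P Q : (Fin n → S) → Prop} (hP : Dfn P) (hQ : Dfn Q) :
    Dfn fun v => P v → Q v := (hP.not.or hQ).congr fun _ => imp_iff_not_or

theorem Dfn.iff {P Q : (Fin n → S) → Prop} (hP : Dfn P) (hQ : Dfn Q) :
    Dfn fun v => P v ↔ Q v := ((hP.imp hQ).and (hQ.imp hP)).congr fun _ => iff_def

theorem Dfn.ex {P : (Fin n → S) → S → Prop}
    (hP : Dfn fun w : Fin (n + 1) → S => P (fun i => w i.castSucc) (w (Fin.last n))) :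
    Dfn fun v => ∃ x, P v x := by
  have h := Set.Definable.image_comp_embedding hP Fin.castSuccEmb
  refine Dfn.congr h fun v => ?_
  constructor
  · rintro ⟨x, hx⟩
    refine ⟨Fin.snoc v x, ?_, ?_⟩
    · simpa using hx
    · ext i
      simp
  · rintro ⟨w, hw, rfl⟩
    exact ⟨_, hw⟩

theorem Dfn.all {P : (Fin n → S) → S → Prop}
    (hP : Dfn fun w : Fin (n + 1) → S => P (fun i => w i.castSucc) (w (Fin.last n))) :
    Dfn fun v => ∀ x, P v x :=
  (Dfn.ex (P := fun v x => ¬ P v x) hP.not).not.congr fun _ => not_exists_not.symm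

theorem Dfn.subset {f g : (Fin n → S) → S} (hf : Trm f) (hg : Trm g) :
    Dfn fun v => IsSubset (f v) (g v) :=
  .all (.imp (.mem .last hf.wk) (.mem .last hg.wk))

theorem Dfn.upair {p f g : (Fin n → S) → S} (hp : Trm p) (hf : Trm f) (hg : Trm g) :
    Dfn fun v => IsUPair (p v) (f v) (g v) :=
  .all (.iff (.mem .last hp.wk) (.or (.eq .last hf.wk) (.eq .last hg.wk)))

theorem Dfn.opair {p f g : (Fin n → S) → S} (hp : Trm p) (hf : Trm f) (hg : Trm g) :
    Dfn fun v => IsOPair (p v) (f v) (g v) :=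
  .ex (.ex (.and (.upair Trm.last.wk hf.wk.wk hf.wk.wk)
    (.and (.upair .last hf.wk.wk hg.wk.wk) (.upair hp.wk.wk Trm.last.wk .last))))

theorem Dfn.maps {h f g : (Fin n → S) → S} (hh : Trm h) (hf : Trm f) (hg : Trm g) :
    Dfn fun v => Maps (h v) (f v) (g v) :=
  .ex (.and (.mem .last hh.wk) (.opair .last hf.wk hg.wk))

theorem Dfn.transSet {f : (Fin n → S) → S} (hf : Trm f) : Dfn fun v => IsTransSet (f v) :=
  .all (.imp (.mem .last hf.wk) (.subset .last hf.wk))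

end Definability

/-! ### Absoluteness for transitive classes -/

section Absoluteness

variable {M : Set ZFSet.{u}}

/-- `M` is a transitive class. -/
def TransClass (M : Set ZFSet.{u}) : Prop := ∀ x ∈ M, ∀ y : ZFSet.{u}, y ∈ x → y ∈ M

theorem TransClass.isSubset_iff (hM : TransClass M) {x y : M} :
    IsSubset x y ↔ (x : ZFSet) ⊆ y :=
  ⟨fun h z hz => h ⟨z, hM _ x.2 _ hz⟩ hz, fun h _ hz => h hz⟩

theorem TransClass.isEmptySet_iff (hM : TransClass M) {x : M} :
    IsEmptySet x ↔ (x : ZFSet) = ∅ := by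
  rw [ZFSet.eq_empty]
  exact ⟨fun h z hz => h ⟨z, hM _ x.2 _ hz⟩ hz, fun h z => h z⟩

theorem TransClass.isUPair_iff (hM : TransClass M) {p a b : M} :
    IsUPair p a b ↔ (p : ZFSet) = {(a : ZFSet), (b : ZFSet)} := by
  constructor
  · intro h
    ext z
    rw [ZFSet.mem_pair]
    constructor
    · intro hz
      exact ((h ⟨z, hM _ p.2 _ hz⟩).1 hz).imp (congrArg Subtype.val) (congrArg Subtype.val)
    · rintro (rfl | rfl)
      · exact (h a).2 (.inl rfl)
      · exact (h b).2 (.inr rfl)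
  · intro h z
    change (z : ZFSet) ∈ (p : ZFSet) ↔ _
    rw [h, ZFSet.mem_pair, Subtype.ext_iff, Subtype.ext_iff]

theorem TransClass.isOPair_iff (hM : TransClass M) {p a b : M} :
    IsOPair p a b ↔ (p : ZFSet) = ZFSet.pair a b := by
  constructor
  · rintro ⟨s, t, hs, ht, hp⟩
    rw [hM.isUPair_iff] at hs ht hp
    rw [hp, hs, ht, ZFSet.pair, ZFSet.pair_eq_singleton]
  · intro h
    have h1 : ({(a : ZFSet)} : ZFSet) ∈ M := hM _ p.2 _ (by rw [h, ZFSet.pair]; simp)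
    have h2 : ({(a : ZFSet), (b : ZFSet)} : ZFSet) ∈ M :=
      hM _ p.2 _ (by rw [h, ZFSet.pair]; simp)
    refine ⟨⟨_, h1⟩, ⟨_, h2⟩, ?_⟩
    simp only [hM.isUPair_iff, h, ZFSet.pair, ZFSet.pair_eq_singleton, and_self]

theorem TransClass.isSucc_iff (hM : TransClass M) {x y : M} :
    IsSucc y x ↔ (y : ZFSet) = insert (x : ZFSet) (x : ZFSet) := by
  constructor
  · intro h
    ext z
    rw [ZFSet.mem_insert_iff, or_comm]
    constructor
    · intro hz
      exact ((h ⟨z, hM _ y.2 _ hz⟩).1 hz).imp id (congrArg Subtype.val)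
    · rintro (hz | rfl)
      · exact (h ⟨z, hM _ x.2 _ hz⟩).2 (.inl hz)
      · exact (h x).2 (.inr rfl)
  · intro h z
    change (z : ZFSet) ∈ (y : ZFSet) ↔ _
    rw [h, ZFSet.mem_insert_iff, or_comm, Subtype.ext_iff]
    rfl

theorem TransClass.isTransSet_iff (hM : TransClass M) {x : M} :
    IsTransSet x ↔ (x : ZFSet).IsTransitive :=
  ⟨fun h y hy => hM.isSubset_iff.1 (h ⟨y, hM _ x.2 _ hy⟩ hy),
    fun h y hy => hM.isSubset_iff.2 (h y hy)⟩

theorem TransClass.isOrd_iff (hM : TransClass M) {x : M} :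
    IsOrd x ↔ (x : ZFSet).IsOrdinal := by
  rw [ZFSet.isOrdinal_iff_forall_mem_isTransitive, IsOrd, hM.isTransSet_iff]
  exact and_congr_right fun _ =>
    ⟨fun h y hy => hM.isTransSet_iff.1 (h ⟨y, hM _ x.2 _ hy⟩ hy),
      fun h y hy => hM.isTransSet_iff.2 (h y hy)⟩

theorem TransClass.maps_iff (hM : TransClass M) {f x y : M} :
    Maps f x y ↔ ZFSet.pair x y ∈ (f : ZFSet) := by
  constructor
  · rintro ⟨p, hp, h⟩
    rw [← hM.isOPair_iff.1 h]
    exact hp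
  · intro h
    exact ⟨⟨_, hM _ f.2 _ h⟩, h, hM.isOPair_iff.2 rfl⟩

/-- The power set in the sense of the class `M`. -/
noncomputable def relPow (M : Set ZFSet.{u}) (x : ZFSet.{u}) : ZFSet.{u} :=
  x.powerset.sep (· ∈ M)

theorem mem_relPow {x y : ZFSet.{u}} : y ∈ relPow M x ↔ y ⊆ x ∧ y ∈ M := by
  simp [relPow]

theorem TransClass.isPowerset_iff (hM : TransClass M) {x y : M} :
    IsPowerset y x ↔ (y : ZFSet) = relPow M x := by
  constructor
  · intro h
    ext z
    rw [mem_relPow]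
    constructor
    · intro hz
      have hzM := hM _ y.2 _ hz
      exact ⟨hM.isSubset_iff.1 ((h ⟨z, hzM⟩).1 hz), hzM⟩
    · rintro ⟨hz, hzM⟩
      exact (h ⟨z, hzM⟩).2 (hM.isSubset_iff.2 hz)
  · intro h z
    change (z : ZFSet) ∈ (y : ZFSet) ↔ _
    rw [h, mem_relPow, hM.isSubset_iff]
    exact and_iff_left z.2

variable {n : ℕ}

theorem Dfn.eqPair (hM : TransClass M) {p f g : (Fin n → M) → M} (hp : Trm p) (hf : Trm f)
    (hg : Trm g) : Dfn fun v => (p v : ZFSet) = ZFSet.pair (f v) (g v) :=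
  (Dfn.opair hp hf hg).congr fun _ => hM.isOPair_iff.symm

theorem Dfn.pairMem (hM : TransClass M) {h f g : (Fin n → M) → M} (hh : Trm h) (hf : Trm f)
    (hg : Trm g) : Dfn fun v => ZFSet.pair (f v) (g v) ∈ (h v : ZFSet) :=
  (Dfn.maps hh hf hg).congr fun _ => hM.maps_iff.symm

theorem Dfn.coeMem {f g : (Fin n → M) → M} (hf : Trm f) (hg : Trm g) :
    Dfn fun v => (f v : ZFSet) ∈ (g v : ZFSet) := Dfn.mem hf hg

theorem Dfn.coeEq {f g : (Fin n → M) → M} (hf : Trm f) (hg : Trm g) :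
    Dfn fun v => (f v : ZFSet) = g v := (Dfn.eq hf hg).congr fun _ => Subtype.ext_iff.symm

theorem Dfn.coeSubset (hM : TransClass M) {f g : (Fin n → M) → M} (hf : Trm f) (hg : Trm g) :
    Dfn fun v => (f v : ZFSet) ⊆ g v :=
  (Dfn.subset hf hg).congr fun _ => hM.isSubset_iff.symm

end Absoluteness

/-! ### Closure properties of transitive models -/

namespace IsTransitiveModelZF

variable {M : Set ZFSet.{u}}

theorem transClass (hM : IsTransitiveModelZF M) : TransClass M := hM.transitive

theorem mem_of_mem (hM : IsTransitiveModelZF M) {x y : ZFSet.{u}} (hx : x ∈ M) (hy : y ∈ x) :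
    y ∈ M := hM.transitive x hx y hy

theorem upair_mem (hM : IsTransitiveModelZF M) {a b : ZFSet.{u}} (ha : a ∈ M) (hb : b ∈ M) :
    ({a, b} : ZFSet) ∈ M := by
  obtain ⟨p, hp⟩ := hM.satisfiesZF.pairing ⟨a, ha⟩ ⟨b, hb⟩
  rw [← hM.transClass.isUPair_iff.1 hp]
  exact p.2

theorem singleton_mem (hM : IsTransitiveModelZF M) {a : ZFSet.{u}} (ha : a ∈ M) :
    ({a} : ZFSet) ∈ M := by
  rw [← ZFSet.pair_eq_singleton]
  exact hM.upair_mem ha ha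

theorem pair_mem (hM : IsTransitiveModelZF M) {a b : ZFSet.{u}} (ha : a ∈ M) (hb : b ∈ M) :
    ZFSet.pair a b ∈ M := hM.upair_mem (hM.singleton_mem ha) (hM.upair_mem ha hb)

theorem mem_of_pair_mem (hM : IsTransitiveModelZF M) {a b : ZFSet.{u}} (h : ZFSet.pair a b ∈ M) :
    a ∈ M ∧ b ∈ M := by
  have h1 : ({a, b} : ZFSet) ∈ M := hM.mem_of_mem h (by simp [ZFSet.pair])
  exact ⟨hM.mem_of_mem h1 (by simp), hM.mem_of_mem h1 (by simp)⟩

theorem sUnion_mem (hM : IsTransitiveModelZF M) {a : ZFSet.{u}} (ha : a ∈ M) :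
    (ZFSet.sUnion a : ZFSet) ∈ M := by
  obtain ⟨y, hy⟩ := hM.satisfiesZF.union ⟨a, ha⟩
  suffices h : (ZFSet.sUnion a : ZFSet) = y by rw [h]; exact y.2
  ext z
  rw [ZFSet.mem_sUnion]
  constructor
  · rintro ⟨w, hw, hz⟩
    have hwM := hM.mem_of_mem ha hw
    exact (hy ⟨z, hM.mem_of_mem hwM hz⟩).2 ⟨⟨w, hwM⟩, hw, hz⟩
  · intro hz
    obtain ⟨w, hw, hz⟩ := (hy ⟨z, hM.mem_of_mem y.2 hz⟩).1 hz
    exact ⟨w, hw, hz⟩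

theorem union_mem (hM : IsTransitiveModelZF M) {a b : ZFSet.{u}} (ha : a ∈ M) (hb : b ∈ M) :
    a ∪ b ∈ M := by
  rw [← ZFSet.sUnion_pair]
  exact hM.sUnion_mem (hM.upair_mem ha hb)

theorem insert_mem (hM : IsTransitiveModelZF M) {a b : ZFSet.{u}} (ha : a ∈ M) (hb : b ∈ M) :
    (insert a b : ZFSet) ∈ M := by
  rw [ZFSet.insert_eq]
  exact hM.union_mem (hM.singleton_mem ha) hb

theorem relPow_mem (hM : IsTransitiveModelZF M) {a : ZFSet.{u}} (ha : a ∈ M) : relPow M a ∈ M := by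
  obtain ⟨p, hp⟩ := hM.satisfiesZF.powerset ⟨a, ha⟩
  rw [← hM.transClass.isPowerset_iff.1 hp]
  exact p.2

theorem empty_mem (hM : IsTransitiveModelZF M) : (∅ : ZFSet) ∈ M := by
  obtain ⟨_, ⟨e, he, _⟩, _⟩ := hM.satisfiesZF.infinity
  rw [← hM.transClass.isEmptySet_iff.1 he]
  exact e.2

theorem sep_mem (hM : IsTransitiveModelZF M) {P : ZFSet.{u} → Prop}
    (hP : Dfn fun v : Fin 1 → M => P (v 0)) {a : ZFSet.{u}} (ha : a ∈ M) : a.sep P ∈ M := by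
  obtain ⟨b, hb⟩ := hM.satisfiesZF.separation {z : M | P z} hP ⟨a, ha⟩
  suffices h : a.sep P = b by rw [h]; exact b.2
  ext z
  rw [ZFSet.mem_sep]
  constructor
  · rintro ⟨hz, hPz⟩
    exact (hb ⟨z, hM.mem_of_mem ha hz⟩).2 ⟨hz, hPz⟩
  · intro hz
    exact (hb ⟨z, hM.mem_of_mem b.2 hz⟩).1 hz

theorem exists_image (hM : IsTransitiveModelZF M) {R : ZFSet.{u} → ZFSet.{u} → Prop}
    (hR : Dfn₂ fun x y : M => R x y) {a : ZFSet.{u}} (ha : a ∈ M)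
    (h : ∀ x ∈ a, ∃! y, y ∈ M ∧ R x y) :
    ∃ b ∈ M, ∀ y, y ∈ b ↔ y ∈ M ∧ ∃ x ∈ a, R x y := by
  obtain ⟨b, hb⟩ := hM.satisfiesZF.replacement {p : M × M | R p.1 p.2} hR ⟨a, ha⟩ (by
    intro x hx
    obtain ⟨y, ⟨hy, hxy⟩, hu⟩ := h x hx
    exact ⟨⟨y, hy⟩, hxy, fun z hz => Subtype.ext (hu z ⟨z.2, hz⟩)⟩)
  refine ⟨b, b.2, fun y => ⟨fun hy => ?_, ?_⟩⟩
  · have hyM := hM.mem_of_mem b.2 hy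
    obtain ⟨x, hx, hxy⟩ := (hb ⟨y, hyM⟩).1 hy
    exact ⟨hyM, x, hx, hxy⟩
  · rintro ⟨hy, x, hx, hxy⟩
    exact (hb ⟨y, hy⟩).2 ⟨⟨x, hM.mem_of_mem ha hx⟩, hx, hxy⟩

/-- The union in `M` of a family of classes, each of which is a set of `M`. -/
theorem exists_iUnion (hM : IsTransitiveModelZF M) {R : ZFSet.{u} → ZFSet.{u} → Prop}
    (hR : Dfn₂ fun x y : M => R x y) {a : ZFSet.{u}} (ha : a ∈ M)
    (h : ∀ x ∈ a, ∃ s ∈ M, ∀ y, y ∈ s ↔ y ∈ M ∧ R x y) :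
    ∃ b ∈ M, ∀ y, y ∈ b ↔ y ∈ M ∧ ∃ x ∈ a, R x y := by
  obtain ⟨c, hc, hc'⟩ := hM.exists_image (R := fun x s => ∀ y : M, (y : ZFSet) ∈ s ↔ R x y)
    (.all (.iff (.coeMem .last (Trm.var 1).wk) (hR.comp (Trm.var 0).wk .last))) ha (by
      intro x hx
      obtain ⟨s, hs, hs'⟩ := h x hx
      refine ⟨s, ⟨hs, fun y => by rw [hs']; exact and_iff_right y.2⟩, ?_⟩
      rintro t ⟨ht, ht'⟩
      ext y
      rw [hs']
      exact ⟨fun hy => ⟨hM.mem_of_mem ht hy, (ht' ⟨y, hM.mem_of_mem ht hy⟩).1 hy⟩,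
        fun hy => (ht' ⟨y, hy.1⟩).2 hy.2⟩)
  refine ⟨_, hM.sUnion_mem hc, fun y => ?_⟩
  rw [ZFSet.mem_sUnion]
  constructor
  · rintro ⟨s, hs, hy⟩
    obtain ⟨hsM, x, hx, hsx⟩ := (hc' s).1 hs
    have hyM := hM.mem_of_mem hsM hy
    exact ⟨hyM, x, hx, (hsx ⟨y, hyM⟩).1 hy⟩
  · rintro ⟨hy, x, hx, hxy⟩
    obtain ⟨s, hs, hs'⟩ := h x hx
    exact ⟨s, (hc' s).2 ⟨hs, x, hx, fun y => by rw [hs']; exact and_iff_right y.2⟩,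
      (hs' y).2 ⟨hy, hxy⟩⟩

theorem prod_mem (hM : IsTransitiveModelZF M) {a b : ZFSet.{u}} (ha : a ∈ M) (hb : b ∈ M) :
    ZFSet.prod a b ∈ M := by
  have h := hM.sep_mem (P := fun p => ∃ x : M, ∃ y : M, ((x : ZFSet) ∈ a ∧ (y : ZFSet) ∈ b) ∧
      p = ZFSet.pair x y)
    (.ex (.ex (.and (.and (.coeMem Trm.last.wk (.const ⟨a, ha⟩)) (.coeMem .last (.const ⟨b, hb⟩)))
      (.eqPair hM.transClass (Trm.var 0).wk.wk Trm.last.wk .last))))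
    (hM.relPow_mem (hM.relPow_mem (hM.union_mem ha hb)))
  convert h
  ext p
  rw [ZFSet.mem_prod, ZFSet.mem_sep]
  constructor
  · rintro ⟨x, hx, y, hy, rfl⟩
    have hxM := hM.mem_of_mem ha hx
    have hyM := hM.mem_of_mem hb hy
    refine ⟨mem_relPow.2 ⟨?_, hM.pair_mem hxM hyM⟩, ⟨x, hxM⟩, ⟨y, hyM⟩, ⟨hx, hy⟩, rfl⟩
    intro z hz
    rw [ZFSet.pair, ZFSet.mem_pair] at hz
    rw [mem_relPow]
    rcases hz with rfl | rfl
    · exact ⟨fun w hw => by simp_all, hM.singleton_mem hxM⟩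
    · refine ⟨fun w hw => ?_, hM.upair_mem hxM hyM⟩
      rw [ZFSet.mem_pair] at hw
      rcases hw with rfl | rfl <;> simp [*]
  · rintro ⟨_, x, y, ⟨hx, hy⟩, rfl⟩
    exact ⟨x, hx, y, hy, rfl⟩

/-- Every set of `M` is included in a least transitive set, which is in `M`. -/
theorem exists_transitive_closure (hM : IsTransitiveModelZF M) {x : ZFSet.{u}} (hx : x ∈ M) :
    ∃ t ∈ M, x ⊆ t ∧ t.IsTransitive ∧ ∀ s : ZFSet, x ⊆ s → s.IsTransitive → t ⊆ s := by
  induction x using ZFSet.inductionOn with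
  | _ x ih =>
    obtain ⟨c, hc, hc'⟩ := hM.exists_image
      (R := fun y t => y ⊆ t ∧ t.IsTransitive ∧
        ∀ s : M, y ⊆ s → (s : ZFSet).IsTransitive → t ⊆ s)
      (.and (.coeSubset hM.transClass (.var 0) (.var 1))
        (.and ((Dfn.transSet (.var 1)).congr fun _ => hM.transClass.isTransSet_iff.symm)
          (.all (.imp (.coeSubset hM.transClass (Trm.var 0).wk .last)
            (.imp ((Dfn.transSet .last).congr fun _ => hM.transClass.isTransSet_iff.symm)
              (.coeSubset hM.transClass (Trm.var 1).wk .last)))))) hx (by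
        intro y hy
        obtain ⟨t, htM, hyt, ht, hl⟩ := ih y hy (hM.mem_of_mem hx hy)
        refine ⟨t, ⟨htM, hyt, ht, fun s => hl s⟩, ?_⟩
        rintro s ⟨hsM, hys, hs, hl'⟩
        exact subset_antisymm (hl' ⟨t, htM⟩ hyt ht) (hl s hys hs))
    refine ⟨x ∪ ZFSet.sUnion c, hM.union_mem hx (hM.sUnion_mem hc), fun z hz => by simp [hz],
      ?_, ?_⟩
    · intro y hy z hz
      rw [ZFSet.mem_union] at hy ⊢
      right
      rw [ZFSet.mem_sUnion] at hy ⊢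
      rcases hy with hy | ⟨t, ht, hyt⟩
      · obtain ⟨t, htM, hyt, ht, hl⟩ := ih y hy (hM.mem_of_mem hx hy)
        exact ⟨t, (hc' t).2 ⟨htM, y, hy, hyt, ht, fun s => hl s⟩, hyt hz⟩
      · obtain ⟨_, _, _, _, htt, _⟩ := (hc' t).1 ht
        exact ⟨t, ht, htt y hyt hz⟩
    · intro s hxs hs z hz
      rw [ZFSet.mem_union, ZFSet.mem_sUnion] at hz
      rcases hz with hz | ⟨t, ht, hzt⟩
      · exact hxs hz
      · obtain ⟨htM, y, hy, hyt, htt, hl⟩ := (hc' t).1 ht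
        obtain ⟨t', htM', hyt', htt', hl'⟩ := ih y hy (hM.mem_of_mem hx hy)
        exact hl' s (hs y (hxs hy)) hs (hl ⟨t', htM'⟩ hyt' htt' hzt)

end IsTransitiveModelZF

/-! ### Recursion inside a transitive model -/

section Recursion

variable {M : Set ZFSet.{u}} {A : ZFSet.{u}} {K R Q : ZFSet.{u} → ZFSet.{u} → Prop}

/-- `h` is an approximation, on an `R`-closed part of `A`, to the function `F` with
`F a = {y | K a y} ∪ ⋃ {{y | Q (F b) y} | b ∈ A, R b a}`. -/
def IsAttempt (M : Set ZFSet.{u}) (A : ZFSet.{u}) (K R Q : ZFSet.{u} → ZFSet.{u} → Prop)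
    (h : ZFSet.{u}) : Prop :=
  ∀ a z : M, ZFSet.pair a z ∈ h → (a : ZFSet) ∈ A ∧
    (∀ b : M, (b : ZFSet) ∈ A → R b a → ∃ w : M, ZFSet.pair b w ∈ h) ∧
    ∀ y : M, (y : ZFSet) ∈ (z : ZFSet) ↔
      K a y ∨ ∃ b : M, (b : ZFSet) ∈ A ∧ R b a ∧ ∃ w : M, ZFSet.pair b w ∈ h ∧ Q w y

/-- `z` is the value at `a` of some approximation in `M`. -/
def AttemptValue (M : Set ZFSet.{u}) (A : ZFSet.{u}) (K R Q : ZFSet.{u} → ZFSet.{u} → Prop)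
    (a z : ZFSet.{u}) : Prop :=
  ∃ h : M, IsAttempt M A K R Q h ∧ ZFSet.pair a z ∈ (h : ZFSet)

theorem dfn_attemptValue (hM : TransClass M) (hA : A ∈ M) (hK : Dfn₂ fun x y : M => K x y)
    (hR : Dfn₂ fun x y : M => R x y) (hQ : Dfn₂ fun x y : M => Q x y) :
    Dfn₂ fun x y : M => AttemptValue M A K R Q x y := by
  refine .ex (.and ?_ (.pairMem hM .last (Trm.var 0).wk (Trm.var 1).wk))
  refine .all (.all (.imp (.pairMem hM Trm.last.wk.wk Trm.last.wk .last)
    (.and (.coeMem Trm.last.wk (.const ⟨A, hA⟩)) (.and ?_ ?_))))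
  · exact .all (.imp (.coeMem .last (.const ⟨A, hA⟩)) (.imp (hR.comp .last Trm.last.wk.wk)
      (.ex (.pairMem hM Trm.last.wk.wk.wk.wk Trm.last.wk .last))))
  · exact .all (.iff (.coeMem .last Trm.last.wk) (.or (hK.comp Trm.last.wk.wk .last)
      (.ex (.and (.coeMem .last (.const ⟨A, hA⟩)) (.and (hR.comp .last Trm.last.wk.wk.wk)
        (.ex (.and (.pairMem hM Trm.last.wk.wk.wk.wk.wk Trm.last.wk .last)
          (hQ.comp .last Trm.last.wk.wk))))))))

/-- Recursion along a well-founded relation `R` on a set `A`, inside `M`: if `F` satisfies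
`F a = {y | K a y} ∪ ⋃ {{y | Q (F b) y} | b ∈ A, R b a}` on `A`, where `K`, `R` and `Q` are definable
over `M` and the classes `{y | K a y}` and `{y | Q z y}` are sets of `M`, then the values of `F` on
`A` and the restriction of `F` to `A` are in `M`. -/
theorem IsTransitiveModelZF.exists_recursion (hM : IsTransitiveModelZF M) (hA : A ∈ M)
    (hK : Dfn₂ fun x y : M => K x y) (hR : Dfn₂ fun x y : M => R x y)
    (hQ : Dfn₂ fun x y : M => Q x y)
    (wf : WellFounded fun b a => b ∈ A ∧ a ∈ A ∧ R b a)
    (hKs : ∀ a ∈ A, ∃ s ∈ M, ∀ y, y ∈ s ↔ K a y)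
    (hQs : ∀ z ∈ M, ∃ s ∈ M, ∀ y, y ∈ s ↔ Q z y)
    (F : ZFSet.{u} → ZFSet.{u})
    (hF : ∀ a ∈ A, ∀ y, y ∈ F a ↔ K a y ∨ ∃ b ∈ A, R b a ∧ Q (F b) y) :
    (∀ a ∈ A, F a ∈ M) ∧ ∃ g ∈ M, ∀ p, p ∈ g ↔ ∃ a ∈ A, p = ZFSet.pair a (F a) := by
  have hA' : ∀ {a}, a ∈ A → a ∈ M := fun h => hM.mem_of_mem hA h
  have hKM : ∀ a ∈ A, ∀ y, K a y → y ∈ M := fun a ha y hy =>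
    let ⟨_, hs, hs'⟩ := hKs a ha
    hM.mem_of_mem hs ((hs' y).2 hy)
  have hQM : ∀ z ∈ M, ∀ y, Q z y → y ∈ M := fun z hz y hy =>
    let ⟨_, hs, hs'⟩ := hQs z hz
    hM.mem_of_mem hs ((hs' y).2 hy)
  -- every approximation agrees with `F`
  have correct : ∀ h ∈ M, IsAttempt M A K R Q h → ∀ a z, ZFSet.pair a z ∈ h → z = F a := by
    intro h hh hatt a
    induction a using wf.induction with
    | _ a ih =>
      intro z haz
      obtain ⟨haM, hzM⟩ := hM.mem_of_pair_mem (hM.mem_of_mem hh haz)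
      obtain ⟨haA, hcl, hval⟩ := hatt ⟨a, haM⟩ ⟨z, hzM⟩ haz
      ext y
      rw [hF a haA]
      have key : ∀ y : M, (y : ZFSet) ∈ z ↔ K a y ∨ ∃ b ∈ A, R b a ∧ Q (F b) y := by
        intro y
        refine (hval y).trans (or_congr Iff.rfl ?_)
        constructor
        · rintro ⟨b, hb, hba, w, hbw, hwy⟩
          rw [ih b ⟨hb, haA, hba⟩ w hbw] at hwy
          exact ⟨b, hb, hba, hwy⟩
        · rintro ⟨b, hb, hba, hwy⟩
          obtain ⟨w, hbw⟩ := hcl ⟨b, hA' hb⟩ hb hba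
          refine ⟨⟨b, hA' hb⟩, hb, hba, w, hbw, ?_⟩
          rwa [ih b ⟨hb, haA, hba⟩ w hbw]
      refine ⟨fun hy => (key ⟨y, hM.mem_of_mem hzM hy⟩).1 hy, fun hy => ?_⟩
      have hyM : y ∈ M := by
        rcases hy with hy | ⟨b, hb, hba, hy⟩
        · exact hKM a haA y hy
        · obtain ⟨w, hbw⟩ := hcl ⟨b, hA' hb⟩ hb hba
          exact hQM _ (ih b ⟨hb, haA, hba⟩ w hbw ▸ w.2) y hy
      exact (key ⟨y, hyM⟩).2 hy
  have hT := dfn_attemptValue hM.transClass hA hK hR hQ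
  have hTF : ∀ {a z}, AttemptValue M A K R Q a z → z = F a := fun ⟨h, hatt, hp⟩ =>
    correct h h.2 hatt _ _ hp
  have hTM : ∀ {a z}, AttemptValue M A K R Q a z → z ∈ M := fun ⟨h, _, hp⟩ =>
    (hM.mem_of_pair_mem (hM.mem_of_mem h.2 hp)).2
  -- the union of all approximations
  have hD := hM.sep_mem (P := fun a => ∃ z : M, AttemptValue M A K R Q a z)
    (.ex (hT.comp (Trm.var 0).wk .last)) hA
  obtain ⟨g, hg, hg'⟩ := hM.exists_image
    (R := fun a p => ∃ z : M, AttemptValue M A K R Q a z ∧ p = ZFSet.pair a z)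
    (.ex (.and (hT.comp (Trm.var 0).wk .last)
      (.eqPair hM.transClass (Trm.var 1).wk (Trm.var 0).wk .last))) hD (by
      intro a ha
      obtain ⟨haA, z, hz⟩ := ZFSet.mem_sep.1 ha
      refine ⟨_, ⟨hM.pair_mem (hA' haA) z.2, z, hz, rfl⟩, ?_⟩
      rintro p ⟨_, w, hw, rfl⟩
      rw [hTF hw, hTF hz])
  have hgp : ∀ a z, ZFSet.pair a z ∈ g ↔ a ∈ A ∧ AttemptValue M A K R Q a z := by
    intro a z
    rw [hg']
    constructor
    · rintro ⟨_, b, hb, w, hw, he⟩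
      obtain ⟨rfl, rfl⟩ := ZFSet.pair_injective he
      exact ⟨(ZFSet.mem_sep.1 hb).1, hw⟩
    · rintro ⟨ha, h⟩
      exact ⟨hM.pair_mem (hA' ha) (hTM h), a, ZFSet.mem_sep.2 ⟨ha, ⟨z, hTM h⟩, h⟩,
        ⟨z, hTM h⟩, h, rfl⟩
  have hgatt : IsAttempt M A K R Q g := by
    intro a z haz
    obtain ⟨haA, h, hatt, hp⟩ := (hgp a z).1 haz
    obtain ⟨_, hcl, hval⟩ := hatt a z hp
    refine ⟨haA, fun b hb hba => ?_, fun y => (hval y).trans (or_congr Iff.rfl ?_)⟩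
    · obtain ⟨w, hw⟩ := hcl b hb hba
      exact ⟨w, (hgp _ _).2 ⟨hb, h, hatt, hw⟩⟩
    · constructor
      · rintro ⟨b, hb, hba, w, hbw, hwy⟩
        exact ⟨b, hb, hba, w, (hgp _ _).2 ⟨hb, h, hatt, hbw⟩, hwy⟩
      · rintro ⟨b, hb, hba, w, hbw, hwy⟩
        obtain ⟨w', hw'⟩ := hcl b hb hba
        refine ⟨b, hb, hba, w', hw', ?_⟩
        rwa [hTF ⟨h, hatt, hw'⟩, ← hTF ((hgp _ _).1 hbw).2]
  -- the domain of that union is all of `A`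
  have main : ∀ a ∈ A, AttemptValue M A K R Q a (F a) := by
    intro a
    induction a using wf.induction with
    | _ a ih =>
      intro haA
      have ih' : ∀ b ∈ A, R b a → AttemptValue M A K R Q b (F b) :=
        fun b hb hba => ih b ⟨hb, haA, hba⟩ hb
      have hFa : F a ∈ M := by
        have hB := hM.sep_mem (P := fun b => R b a)
          (hR.comp (.var 0) (.const ⟨a, hA' haA⟩)) hA
        obtain ⟨s, hs, hs'⟩ := hM.exists_iUnion
          (R := fun b y => ∃ w : M, AttemptValue M A K R Q b w ∧ Q w y)
          (.ex (.and (hT.comp (Trm.var 0).wk .last) (hQ.comp .last (Trm.var 1).wk))) hB (by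
            intro b hb
            obtain ⟨hbA, hba⟩ := ZFSet.mem_sep.1 hb
            have hT := ih' b hbA hba
            obtain ⟨s, hs, hs'⟩ := hQs (F b) (hTM hT)
            refine ⟨s, hs, fun y => (hs' y).trans
              ⟨fun hy => ⟨hQM _ (hTM hT) y hy, ⟨_, hTM hT⟩, hT, hy⟩, ?_⟩⟩
            rintro ⟨_, w, hw, hwy⟩
            rwa [← hTF hw])
        obtain ⟨k, hk, hk'⟩ := hKs a haA
        convert hM.union_mem hk hs
        ext y
        rw [hF a haA, ZFSet.mem_union, hk', hs']
        refine or_congr Iff.rfl ?_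
        constructor
        · rintro ⟨b, hb, hba, hy⟩
          have hTb := ih' b hb hba
          exact ⟨hQM _ (hTM hTb) y hy, b, ZFSet.mem_sep.2 ⟨hb, hba⟩, ⟨_, hTM hTb⟩, hTb, hy⟩
        · rintro ⟨_, b, hb, w, hw, hwy⟩
          obtain ⟨hbA, hba⟩ := ZFSet.mem_sep.1 hb
          exact ⟨b, hbA, hba, by rwa [← hTF hw]⟩
      refine ⟨⟨insert (ZFSet.pair a (F a)) g, hM.insert_mem (hM.pair_mem (hA' haA) hFa) hg⟩, ?_,
        ZFSet.mem_insert _ _⟩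
      have hmem : ∀ b w, ZFSet.pair b w ∈ insert (ZFSet.pair a (F a)) g ↔
          (b = a ∧ w = F a) ∨ ZFSet.pair b w ∈ g := by
        intro b w
        rw [ZFSet.mem_insert_iff, ZFSet.pair_inj]
      have hins : ∀ b ∈ A, R b a → ZFSet.pair b (F b) ∈ g := fun b hb hba =>
        (hgp _ _).2 ⟨hb, ih' b hb hba⟩
      have hval : ∀ b w, ZFSet.pair b w ∈ insert (ZFSet.pair a (F a)) g → w = F b := by
        intro b w hbw
        rcases (hmem _ _).1 hbw with ⟨rfl, h⟩ | h
        · exact h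
        · exact hTF ((hgp _ _).1 h).2
      intro c z hcz
      change ZFSet.pair (c : ZFSet) z ∈ insert (ZFSet.pair a (F a)) g at hcz
      change (c : ZFSet) ∈ A ∧ (∀ b : M, (b : ZFSet) ∈ A → R b c → ∃ w : M,
        ZFSet.pair b w ∈ insert (ZFSet.pair a (F a)) g) ∧ ∀ y : M, (y : ZFSet) ∈ (z : ZFSet) ↔
        K c y ∨ ∃ b : M, (b : ZFSet) ∈ A ∧ R b c ∧ ∃ w : M,
          ZFSet.pair b w ∈ insert (ZFSet.pair a (F a)) g ∧ Q w y
      have hcA : (c : ZFSet) ∈ A := by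
        rcases (hmem _ _).1 hcz with ⟨h, _⟩ | h
        · rwa [h]
        · exact ((hgp _ _).1 h).1
      have hcl : ∀ b : M, (b : ZFSet) ∈ A → R b c → ∃ w : M,
          ZFSet.pair b w ∈ insert (ZFSet.pair a (F a)) g := by
        intro b hb hbc
        rcases (hmem _ _).1 hcz with ⟨h, _⟩ | h
        · rw [h] at hbc
          exact ⟨⟨_, hTM (ih' b hb hbc)⟩, (hmem _ _).2 (.inr (hins b hb hbc))⟩
        · obtain ⟨w, hw⟩ := (hgatt c z h).2.1 b hb hbc
          exact ⟨w, (hmem _ _).2 (.inr hw)⟩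
      refine ⟨hcA, hcl, fun y => ?_⟩
      rw [hval _ _ hcz, hF _ hcA]
      refine or_congr Iff.rfl ⟨?_, ?_⟩
      · rintro ⟨b, hb, hbc, hy⟩
        obtain ⟨w, hw⟩ := hcl ⟨b, hA' hb⟩ hb hbc
        exact ⟨⟨b, hA' hb⟩, hb, hbc, w, hw, by rwa [hval _ _ hw]⟩
      · rintro ⟨b, hb, hbc, w, hw, hy⟩
        exact ⟨b, hb, hbc, by rwa [← hval _ _ hw]⟩
  refine ⟨fun a ha => hTM (main a ha), g, hg, fun p => ?_⟩
  rw [hg']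
  constructor
  · rintro ⟨_, a, ha, z, hz, rfl⟩
    exact ⟨a, (ZFSet.mem_sep.1 ha).1, by rw [hTF hz]⟩
  · rintro ⟨a, ha, rfl⟩
    have h := main a ha
    exact ⟨hM.pair_mem (hA' ha) (hTM h), a, ZFSet.mem_sep.2 ⟨ha, ⟨_, hTM h⟩, h⟩, ⟨_, hTM h⟩, h, rfl⟩

end Recursion

/-! ### The iterated power set in a transitive model -/

/-- The function `F` with `F a = K a ∪ ⋃ {H (F b) | b ∈ p a}`, defined by recursion along the
well-founded relation `b ∈ p a`. -/
noncomputable def wfRec (p K H : ZFSet.{u} → ZFSet.{u}) (wf : WellFounded fun b a => b ∈ p a) :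
    ZFSet.{u} → ZFSet.{u} :=
  wf.fix fun a ih => K a ∪ ZFSet.iUnion fun b : p a => H (ih b b.2)

theorem mem_wfRec {p K H : ZFSet.{u} → ZFSet.{u}} (wf : WellFounded fun b a => b ∈ p a)
    {a y : ZFSet.{u}} : y ∈ wfRec p K H wf a ↔ y ∈ K a ∨ ∃ b ∈ p a, y ∈ H (wfRec p K H wf b) := by
  rw [wfRec, wf.fix_eq, ZFSet.mem_union, ZFSet.mem_iUnion]
  simp only [Subtype.exists, exists_prop]

/-- The iterated power set `𝒫^β(η)` in the sense of the class `M`, by the uniform recursion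
`𝒫^β(η) = η ∪ ⋃ {𝒫(𝒫^γ(η)) | γ ∈ β}`. -/
noncomputable def hier (M : Set ZFSet.{u}) (η : ZFSet.{u}) : ZFSet.{u} → ZFSet.{u} :=
  wfRec id (fun _ => η) (relPow M) ZFSet.mem_wf

variable {M : Set ZFSet.{u}} {η β γ x y : ZFSet.{u}}

theorem mem_hier : y ∈ hier M η β ↔ y ∈ η ∨ ∃ γ ∈ β, y ⊆ hier M η γ ∧ y ∈ M := by
  rw [hier, mem_wfRec]
  simp only [mem_relPow, id]

theorem subset_hier : η ⊆ hier M η β := fun _ hy => mem_hier.2 (.inl hy)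

theorem hier_mono_right (h : γ ⊆ β) : hier M η γ ⊆ hier M η β := fun _ hy =>
  mem_hier.2 ((mem_hier.1 hy).imp id fun ⟨δ, hδ, h'⟩ => ⟨δ, h hδ, h'⟩)

theorem hier_mono_left {η' : ZFSet.{u}} (h : η ⊆ η') : hier M η β ⊆ hier M η' β := by
  induction β using ZFSet.inductionOn with
  | _ β ih =>
    exact fun y hy => mem_hier.2 ((mem_hier.1 hy).imp (fun hy => h hy)
      fun ⟨δ, hδ, hy, hyM⟩ => ⟨δ, hδ, fun z hz => ih δ hδ (hy hz), hyM⟩)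

theorem hier_empty : hier M η ∅ = η := by
  ext y
  rw [mem_hier]
  simp

/-- The uniform recursion agrees with the usual one at successors, because a transitive base `η` is
included in every power set `𝒫(𝒫^γ(η))`. -/
theorem hier_succ (hM : TransClass M) (hηM : η ∈ M) (hη : η.IsTransitive)
    (hγ : γ.IsTransitive) : hier M η (insert γ γ) = relPow M (hier M η γ) := by
  ext y
  rw [mem_hier, mem_relPow]
  constructor
  · rintro (hy | ⟨δ, hδ, hy, hyM⟩)
    · exact ⟨fun z hz => subset_hier (hη y hy hz), hM _ hηM _ hy⟩
    · refine ⟨fun z hz => ?_, hyM⟩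
      rcases ZFSet.mem_insert_iff.1 hδ with rfl | hδ
      · exact hy hz
      · exact hier_mono_right (hγ δ hδ) (hy hz)
  · exact fun h => .inr ⟨γ, ZFSet.mem_insert _ _, h⟩

theorem mem_hier_limit (hM : TransClass M) (hηM : η ∈ M) (hη : η.IsTransitive)
    (hβ : β.IsOrdinal) (h0 : β ≠ ∅) (hs : ∀ γ ∈ β, β ≠ insert γ γ) :
    y ∈ hier M η β ↔ ∃ γ ∈ β, y ∈ hier M η γ := by
  constructor
  · intro hy
    rcases mem_hier.1 hy with hy | ⟨γ, hγ, hy⟩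
    · obtain h | ⟨γ, hγ⟩ := ZFSet.eq_empty_or_nonempty β
      · exact absurd h h0
      · exact ⟨γ, hγ, subset_hier hy⟩
    · refine ⟨insert γ γ, ?_, ?_⟩
      · have hγo := hβ.mem hγ
        refine (((ZFSet.isOrdinal_succ hγo).subset_iff_eq_or_mem hβ).1 ?_).resolve_left
          (hs γ hγ).symm
        intro z hz
        rcases ZFSet.mem_insert_iff.1 hz with rfl | hz
        · exact hγ
        · exact hβ.mem_trans hz hγ
      · rw [hier_succ hM hηM hη (hβ.mem hγ).isTransitive]
        exact mem_relPow.2 hy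
  · rintro ⟨γ, hγ, hy⟩
    exact hier_mono_right (hβ.subset_of_mem hγ) hy

/-- A power hierarchy in `M` consists of the iterated power sets in the sense of `M`. -/
theorem IsPowerHierarchy.eq_hier (hM : TransClass M) {f η α : M} (hη : (η : ZFSet).IsOrdinal)
    (hα : (α : ZFSet).IsOrdinal) (hf : IsPowerHierarchy f η α) :
    ∀ β y : M, Maps f β y → (y : ZFSet) = hier M η β := by
  obtain ⟨hf1, hf2, hf3⟩ := hf
  have hdom : ∀ β y : M, Maps f β y → (β : ZFSet) ∈ (insert (α : ZFSet) (α : ZFSet) : ZFSet) := by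
    rintro β y ⟨p, hp, hpair⟩
    obtain ⟨β', y', hβ', hpair'⟩ := hf1 p hp
    rw [hM.isOPair_iff] at hpair hpair'
    rw [hpair, ZFSet.pair_inj, ← Subtype.ext_iff] at hpair'
    rw [hpair'.1, ZFSet.mem_insert_iff, or_comm, ← Subtype.ext_iff]
    exact hβ'
  have hex : ∀ β : M, (β : ZFSet) ∈ (insert (α : ZFSet) (α : ZFSet) : ZFSet) →
      ∃ y : M, Maps f β y := by
    intro β hβ
    rw [ZFSet.mem_insert_iff, or_comm, ← Subtype.ext_iff] at hβ
    exact (hf2 β hβ).exists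
  rintro ⟨β, hβM⟩
  induction β using ZFSet.inductionOn with
  | _ β ih =>
    intro y hy
    have hβ := hdom _ _ hy
    have hα' := ZFSet.isOrdinal_succ hα
    have hβo : β.IsOrdinal := hα'.mem hβ
    have hlow : ∀ γ : M, (γ : ZFSet) ∈ β → ∃ z : M, Maps f γ z := fun γ hγ =>
      hex γ (hα'.mem_trans hγ hβ)
    obtain ⟨h0, h1, h2⟩ := hf3 _ _ hy
    change (y : ZFSet) = hier M η β
    by_cases hβ0 : β = ∅
    · rw [h0 (hM.isEmptySet_iff.2 hβ0), hβ0, hier_empty]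
    by_cases hβs : ∃ γ ∈ β, β = insert γ γ
    · obtain ⟨γ, hγ, rfl⟩ := hβs
      have hγM := hM _ hβM _ hγ
      obtain ⟨z, hz⟩ := hlow ⟨γ, hγM⟩ hγ
      have := hM.isPowerset_iff.1 (h1 ⟨γ, hγM⟩ z (hM.isSucc_iff.2 rfl) hz)
      rw [this, ih γ hγ hγM z hz, hier_succ hM η.2 hη.isTransitive (hβo.mem hγ).isTransitive]
    · push Not at hβs
      have hlim := h2 ⟨hM.isOrd_iff.2 hβo, fun h => hβ0 (hM.isEmptySet_iff.1 h), fun γ h => by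
        have h := hM.isSucc_iff.1 h
        exact hβs γ (by rw [show β = _ from h]; exact ZFSet.mem_insert _ _) h⟩
      ext w
      rw [mem_hier_limit hM η.2 hη.isTransitive hβo hβ0 hβs]
      constructor
      · intro hw
        obtain ⟨γ, z, hγ, hγz, hwz⟩ := (hlim ⟨w, hM _ y.2 _ hw⟩).1 hw
        refine ⟨γ, hγ, ?_⟩
        rw [← ih γ hγ γ.2 z hγz]
        exact hwz
      · rintro ⟨γ, hγ, hw⟩
        obtain ⟨z, hz⟩ := hlow ⟨γ, hM _ hβM _ hγ⟩ hγ
        rw [← ih γ hγ (hM _ hβM _ hγ) z hz] at hw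
        exact (hlim ⟨w, hM _ z.2 _ hw⟩).2 ⟨_, z, hγ, hz, hw⟩

namespace IsTransitiveModelZF

theorem hier_mem_and_graph (hM : IsTransitiveModelZF M) {α : ZFSet.{u}} (hηM : η ∈ M)
    (hαM : α ∈ M) (hα : α.IsOrdinal) : (∀ β ∈ (insert α α : ZFSet), hier M η β ∈ M) ∧
      ∃ g ∈ M, ∀ p, p ∈ g ↔ ∃ β ∈ (insert α α : ZFSet), p = ZFSet.pair β (hier M η β) := by
  refine hM.exists_recursion (K := fun _ y => y ∈ η) (R := fun b a => b ∈ a)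
    (Q := fun z y => y ⊆ z ∧ y ∈ M)
    (hM.insert_mem hαM hαM) (.coeMem (.var 1) (.const (⟨η, hηM⟩ : M))) (.coeMem (.var 0) (.var 1))
    ((Dfn.coeSubset hM.transClass (.var 1) (.var 0)).congr fun v => and_iff_left (v 1).2)
    ?_ ?_ ?_ _ ?_
  · exact Subrelation.wf (fun h => h.2.2) ZFSet.mem_wf
  · exact fun _ _ => ⟨η, hηM, fun _ => Iff.rfl⟩
  · exact fun z hz => ⟨_, hM.relPow_mem hz, fun _ => mem_relPow⟩
  · intro a ha y
    rw [mem_hier]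
    exact or_congr Iff.rfl
      ⟨fun ⟨γ, hγ, hy⟩ => ⟨γ, (ZFSet.isOrdinal_succ hα).mem_trans hγ ha, hγ, hy⟩,
        fun ⟨γ, _, hγ, hy⟩ => ⟨γ, hγ, hy⟩⟩

theorem hier_mem (hM : IsTransitiveModelZF M) (hηM : η ∈ M) (hβM : β ∈ M) (hβ : β.IsOrdinal) :
    hier M η β ∈ M := (hM.hier_mem_and_graph hηM hβM hβ).1 β (ZFSet.mem_insert _ _)

theorem exists_isPowerHierarchy (hM : IsTransitiveModelZF M) {η α : M}
    (hη : (η : ZFSet).IsOrdinal) (hα : (α : ZFSet).IsOrdinal) :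
    ∃ f : M, IsPowerHierarchy f η α ∧ ∃ y : M, (y : ZFSet) = hier M η α ∧ Maps f α y := by
  obtain ⟨hmem, g, hg, hg'⟩ := hM.hier_mem_and_graph η.2 α.2 hα
  have hT := hM.transClass
  have hmaps : ∀ β y : M, Maps (⟨g, hg⟩ : M) β y ↔
      (β ∈ α ∨ β = α) ∧ (y : ZFSet) = hier M η β := by
    intro β y
    rw [hT.maps_iff, hg']
    constructor
    · rintro ⟨β', hβ', he⟩
      obtain ⟨rfl, h⟩ := ZFSet.pair_injective he
      rw [ZFSet.mem_insert_iff, or_comm, ← Subtype.ext_iff] at hβ'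
      exact ⟨hβ', h⟩
    · rintro ⟨hβ, h⟩
      rw [Subtype.ext_iff, or_comm] at hβ
      exact ⟨β, ZFSet.mem_insert_iff.2 hβ, by rw [h]⟩
  have hdom : ∀ β : M, β ∈ α ∨ β = α → (β : ZFSet) ∈ (insert (α : ZFSet) (α : ZFSet) : ZFSet) := by
    intro β hβ
    rw [Subtype.ext_iff, or_comm] at hβ
    exact ZFSet.mem_insert_iff.2 hβ
  have hα' := ZFSet.isOrdinal_succ hα
  refine ⟨⟨g, hg⟩, ⟨?_, ?_, ?_⟩, ⟨_, hmem α (ZFSet.mem_insert _ _)⟩, rfl,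
    (hmaps _ _).2 ⟨.inr rfl, rfl⟩⟩
  · intro p hp
    obtain ⟨β, hβ, he⟩ := (hg' p).1 hp
    have hβM := hM.mem_of_mem (hM.insert_mem α.2 α.2) hβ
    rw [ZFSet.mem_insert_iff, or_comm] at hβ
    exact ⟨⟨β, hβM⟩, ⟨_, (hM.mem_of_pair_mem (he ▸ p.2)).2⟩, by rwa [Subtype.ext_iff],
      hT.isOPair_iff.2 he⟩
  · intro β hβ
    exact ⟨⟨_, hmem β (hdom β hβ)⟩, (hmaps _ _).2 ⟨hβ, rfl⟩,
      fun y hy => Subtype.ext ((hmaps _ _).1 hy).2⟩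
  · intro β y hy
    obtain ⟨hβ, hy⟩ := (hmaps _ _).1 hy
    have hβo := hα'.mem (hdom β hβ)
    have hlow : ∀ γ : M, γ ∈ β → γ ∈ α ∨ γ = α := by
      intro γ hγ
      have := hα'.mem_trans (show (γ : ZFSet) ∈ (β : ZFSet) from hγ) (hdom β hβ)
      rwa [ZFSet.mem_insert_iff, or_comm, ← Subtype.ext_iff] at this
    refine ⟨?_, ?_, ?_⟩
    · intro h
      rw [hT.isEmptySet_iff] at h
      rw [h, hier_empty] at hy
      exact Subtype.ext hy
    · intro γ z hγ hz
      rw [hT.isSucc_iff] at hγ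
      have hγβ : (γ : ZFSet) ∈ (β : ZFSet) := by rw [hγ]; exact ZFSet.mem_insert _ _
      rw [hT.isPowerset_iff, hy, hγ, ((hmaps _ _).1 hz).2,
        hier_succ hT η.2 hη.isTransitive (hβo.mem hγβ).isTransitive]
    · rintro ⟨_, hne, hns⟩ w
      change (w : ZFSet) ∈ (y : ZFSet) ↔ _
      rw [hT.isEmptySet_iff] at hne
      rw [hy, mem_hier_limit hT η.2 hη.isTransitive hβo hne fun γ hγ h =>
        hns ⟨γ, hM.mem_of_mem β.2 hγ⟩ (hT.isSucc_iff.2 h)]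
      constructor
      · rintro ⟨γ, hγ, hw⟩
        have hγ' := hlow ⟨γ, hM.mem_of_mem β.2 hγ⟩ hγ
        exact ⟨⟨γ, hM.mem_of_mem β.2 hγ⟩, ⟨_, hmem γ (hdom _ hγ')⟩, hγ, (hmaps _ _).2 ⟨hγ', rfl⟩, hw⟩
      · rintro ⟨γ, z, hγ, hz, hw⟩
        refine ⟨γ, hγ, ?_⟩
        rw [← ((hmaps _ _).1 hz).2]
        exact hw

theorem isAlphaSet_iff (hM : IsTransitiveModelZF M) {α x : M} (hα : (α : ZFSet).IsOrdinal) :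
    IsAlphaSet α x ↔ ∃ η ∈ M, η.IsOrdinal ∧ (x : ZFSet) ⊆ hier M η α := by
  have hT := hM.transClass
  constructor
  · rintro ⟨η, f, y, hη, hf, hy, hx⟩
    rw [hT.isOrd_iff] at hη
    rw [hT.isSubset_iff, hf.eq_hier hT hη hα _ _ hy] at hx
    exact ⟨η, η.2, hη, hx⟩
  · rintro ⟨η, hηM, hη, hx⟩
    obtain ⟨f, hf, y, hy, hfy⟩ := hM.exists_isPowerHierarchy (η := ⟨η, hηM⟩) hη hα
    exact ⟨⟨η, hηM⟩, f, y, hT.isOrd_iff.2 hη, hf, hfy, hT.isSubset_iff.2 (by rwa [hy])⟩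

theorem mem_alphaSets_iff (hM : IsTransitiveModelZF M) {α : Ordinal.{u}} :
    x ∈ alphaSets M α ↔ α.toZFSet ∈ M ∧ x ∈ M ∧
      ∃ η ∈ M, η.IsOrdinal ∧ x ⊆ hier M η α.toZFSet := by
  constructor
  · rintro ⟨hα, hx, h⟩
    exact ⟨hα, hx, (hM.isAlphaSet_iff (ZFSet.isOrdinal_toZFSet α)).1 h⟩
  · rintro ⟨hα, hx, h⟩
    exact ⟨hα, hx, (hM.isAlphaSet_iff (ZFSet.isOrdinal_toZFSet α)).2 h⟩

end IsTransitiveModelZF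

/-! ### Shifting the base of the iterated power set -/

open Classical in
/-- The map on sets over the base `η` that replaces hereditarily each `ξ ∈ η` by `κ + ξ`. -/
noncomputable def shift (η κ : ZFSet.{u}) : ZFSet.{u} → ZFSet.{u} :=
  wfRec id (fun x => if x ∈ η then κ else ∅) (fun z => {z}) ZFSet.mem_wf

/-- The image of `x` under `shift η κ`. -/
noncomputable def shiftImage (η κ x : ZFSet.{u}) : ZFSet.{u} :=
  ZFSet.iUnion fun z : x => {shift η κ z}

/-- The ordinal sum `κ + η`. -/
noncomputable def shiftSum (η κ : ZFSet.{u}) : ZFSet.{u} := κ ∪ shiftImage η κ η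

/-- A pairing function that does not raise the level in the iterated power set over `η`: it is the
union of the images of `x` and `y` under shifts by `1` and by `1 + η`. -/
noncomputable def flatPair (η x y : ZFSet.{u}) : ZFSet.{u} :=
  shiftImage η {∅} x ∪ shiftImage η (shiftSum η {∅}) y

variable {M : Set ZFSet.{u}} {η κ κ' α x x' y y' z : ZFSet.{u}}

theorem mem_shift : y ∈ shift η κ x ↔ (x ∈ η ∧ y ∈ κ) ∨ ∃ z ∈ x, y = shift η κ z := by
  rw [shift, mem_wfRec]
  refine or_congr ?_ (by simp)
  by_cases hx : x ∈ η <;> simp [hx]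

theorem mem_shiftImage : y ∈ shiftImage η κ x ↔ ∃ z ∈ x, y = shift η κ z := by
  simp [shiftImage, ZFSet.mem_iUnion]

theorem mem_shiftSum : y ∈ shiftSum η κ ↔ y ∈ κ ∨ ∃ z ∈ η, y = shift η κ z := by
  rw [shiftSum, ZFSet.mem_union, mem_shiftImage]

theorem mem_flatPair : z ∈ flatPair η x y ↔ (∃ w ∈ x, z = shift η {∅} w) ∨
    ∃ w ∈ y, z = shift η (shiftSum η {∅}) w := by
  rw [flatPair, ZFSet.mem_union, mem_shiftImage, mem_shiftImage]

theorem shift_ne_empty (hη : ∅ ∈ η) (hκ : ∅ ∈ κ) : shift η κ x ≠ ∅ := by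
  intro h
  by_cases hx : x ∈ η
  · have h' : ∅ ∈ shift η κ x := mem_shift.2 (.inl ⟨hx, hκ⟩)
    exact ZFSet.notMem_empty ∅ (by rwa [h] at h')
  · obtain rfl | ⟨z, hz⟩ := ZFSet.eq_empty_or_nonempty x
    · exact hx hη
    · exact ZFSet.notMem_empty _ (h ▸ mem_shift.2 (.inr ⟨z, hz, rfl⟩))

/-- The set `∅` marks the shifts of elements of the base. -/
theorem empty_mem_shift_iff (hη : ∅ ∈ η) (hκ : ∅ ∈ κ) : ∅ ∈ shift η κ x ↔ x ∈ η := by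
  rw [mem_shift]
  constructor
  · rintro (⟨h, _⟩ | ⟨z, _, h⟩)
    · exact h
    · exact absurd h.symm (shift_ne_empty hη hκ)
  · exact fun h => .inl ⟨h, hκ⟩

/-- The map `ξ ↦ κ + ξ` takes no value below `κ`: otherwise `κ + ξ` would be an element of itself. -/
theorem shift_notMem (hx : x ∈ η) : shift η κ x ∉ κ := fun h =>
  ZFSet.mem_irrefl _ (mem_shift.2 (.inl ⟨hx, h⟩) : shift η κ x ∈ shift η κ x)

theorem shift_injective (hηt : η.IsTransitive) (hη : ∅ ∈ η) (hκ : ∅ ∈ κ) :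
    Function.Injective (shift η κ) := by
  intro x
  induction x using ZFSet.inductionOn with
  | _ x ih =>
    intro y h
    have hiff : x ∈ η ↔ y ∈ η := by
      rw [← empty_mem_shift_iff hη hκ, h, empty_mem_shift_iff hη hκ]
    have hsub : ∀ x y, shift η κ x = shift η κ y → (x ∈ η ↔ y ∈ η) → ∀ z ∈ x,
        ∃ w ∈ y, shift η κ z = shift η κ w := by
      intro x y h hiff z hz
      have hz' : shift η κ z ∈ shift η κ y := h ▸ mem_shift.2 (.inr ⟨z, hz, rfl⟩)
      rcases mem_shift.1 hz' with ⟨hy, hzκ⟩ | hw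
      · exact absurd hzκ (shift_notMem (hηt x (hiff.2 hy) hz))
      · exact hw
    ext z
    constructor
    · intro hz
      obtain ⟨w, hw, hzw⟩ := hsub x y h hiff z hz
      rwa [ih z hz hzw]
    · intro hz
      obtain ⟨w, hw, hzw⟩ := hsub y x h.symm hiff.symm z hz
      rwa [← ih w hw hzw.symm]

/-- The shifts by `κ` and by `κ + η` have disjoint ranges. -/
theorem shift_ne_shift (hη : ∅ ∈ η) (hκ : ∅ ∈ κ) (x y : ZFSet.{u}) :
    shift η κ x ≠ shift η (shiftSum η κ) y := by
  have hκ' : ∅ ∈ shiftSum η κ := mem_shiftSum.2 (.inl hκ)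
  induction x using ZFSet.inductionOn generalizing y with
  | _ x ih =>
    intro h
    have hiff : x ∈ η ↔ y ∈ η := by
      rw [← empty_mem_shift_iff hη hκ, h, empty_mem_shift_iff hη hκ']
    by_cases hx : x ∈ η
    · have h1 : shift η κ x ∈ shiftSum η κ := mem_shiftSum.2 (.inr ⟨x, hx, rfl⟩)
      rw [h] at h1
      exact shift_notMem (hiff.1 hx) h1
    · obtain rfl | ⟨z, hz⟩ := ZFSet.eq_empty_or_nonempty x
      · exact hx hη
      · have hz' : shift η κ z ∈ shift η (shiftSum η κ) y :=
          h ▸ mem_shift.2 (.inr ⟨z, hz, rfl⟩)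
        rcases mem_shift.1 hz' with ⟨hy, _⟩ | ⟨w, _, hw⟩
        · exact hx (hiff.2 hy)
        · exact ih z hz w hw

theorem flatPair_inj (hηt : η.IsTransitive) (hη : ∅ ∈ η)
    (h : flatPair η x y = flatPair η x' y') : x = x' ∧ y = y' := by
  have h0 : (∅ : ZFSet) ∈ ({∅} : ZFSet) := ZFSet.mem_singleton.2 rfl
  have h1 : ∅ ∈ shiftSum η {∅} := mem_shiftSum.2 (.inl h0)
  have hx : ∀ x y w, shift η {∅} w ∈ flatPair η x y ↔ w ∈ x := by
    intro x y w
    rw [mem_flatPair]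
    constructor
    · rintro (⟨v, hv, hw⟩ | ⟨v, _, hw⟩)
      · rwa [shift_injective hηt hη h0 hw]
      · exact absurd hw (shift_ne_shift hη h0 w v)
    · exact fun hw => .inl ⟨w, hw, rfl⟩
  have hy : ∀ x y w, shift η (shiftSum η {∅}) w ∈ flatPair η x y ↔ w ∈ y := by
    intro x y w
    rw [mem_flatPair]
    constructor
    · rintro (⟨v, _, hw⟩ | ⟨v, hv, hw⟩)
      · exact absurd hw.symm (shift_ne_shift hη h0 v w)
      · rwa [shift_injective hηt hη h1 hw]
    · exact fun hw => .inr ⟨w, hw, rfl⟩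
  constructor <;> ext w
  · rw [← hx x y, h, hx]
  · rw [← hy x y, h, hy]

theorem shift_isOrdinal (hη : η.IsOrdinal) (hκ : κ.IsOrdinal) (hx : x ∈ η) :
    (shift η κ x).IsOrdinal := by
  induction x using ZFSet.inductionOn with
  | _ x ih =>
    have hη' : ∀ {y}, y ∈ x → y ∈ η := fun hy => hη.mem_trans hy hx
    rw [ZFSet.isOrdinal_iff_forall_mem_isTransitive]
    constructor
    · intro y hy z hz
      rcases mem_shift.1 hy with ⟨_, hy⟩ | ⟨w, hw, rfl⟩
      · exact mem_shift.2 (.inl ⟨hx, hκ.mem_trans hz hy⟩)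
      · rcases mem_shift.1 hz with ⟨_, hz⟩ | ⟨v, hv, rfl⟩
        · exact mem_shift.2 (.inl ⟨hx, hz⟩)
        · exact mem_shift.2 (.inr ⟨v, (hη.mem hx).mem_trans hv hw, rfl⟩)
    · intro y hy
      rcases mem_shift.1 hy with ⟨_, hy⟩ | ⟨w, hw, rfl⟩
      · exact (hκ.mem hy).isTransitive
      · exact (ih w hw (hη' hw)).isTransitive

theorem shiftSum_isOrdinal (hη : η.IsOrdinal) (hκ : κ.IsOrdinal) : (shiftSum η κ).IsOrdinal := by
  rw [ZFSet.isOrdinal_iff_forall_mem_isTransitive]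
  constructor
  · intro y hy z hz
    rcases mem_shiftSum.1 hy with hy | ⟨w, hw, rfl⟩
    · exact mem_shiftSum.2 (.inl (hκ.mem_trans hz hy))
    · rcases mem_shift.1 hz with ⟨_, hz⟩ | ⟨v, hv, rfl⟩
      · exact mem_shiftSum.2 (.inl hz)
      · exact mem_shiftSum.2 (.inr ⟨v, hη.mem_trans hv hw, rfl⟩)
  · intro y hy
    rcases mem_shiftSum.1 hy with hy | ⟨w, hw, rfl⟩
    · exact (hκ.mem hy).isTransitive
    · exact (shift_isOrdinal hη hκ hw).isTransitive

theorem singleton_empty_isOrdinal : ({∅} : ZFSet.{u}).IsOrdinal := by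
  have h := ZFSet.isOrdinal_succ ZFSet.isOrdinal_empty.{u}
  rwa [ZFSet.insert_eq, show ({∅} ∪ ∅ : ZFSet.{u}) = {∅} by ext; simp] at h

namespace IsTransitiveModelZF

theorem shift_graph (hM : IsTransitiveModelZF M) (hη : η ∈ M) (hκ : κ ∈ M) {B : ZFSet.{u}}
    (hB : B ∈ M) (hBt : B.IsTransitive) : (∀ x ∈ B, shift η κ x ∈ M) ∧
      ∃ g ∈ M, ∀ p, p ∈ g ↔ ∃ x ∈ B, p = ZFSet.pair x (shift η κ x) := by
  refine hM.exists_recursion (K := fun a y => a ∈ η ∧ y ∈ κ) (R := fun b a => b ∈ a)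
    (Q := fun z y => y = z) hB
    (.and (.coeMem (.var 0) (.const (⟨η, hη⟩ : M))) (.coeMem (.var 1) (.const (⟨κ, hκ⟩ : M))))
    (.coeMem (.var 0) (.var 1)) (.coeEq (.var 1) (.var 0)) ?_ ?_ ?_ _ ?_
  · exact Subrelation.wf (fun h => h.2.2) ZFSet.mem_wf
  · intro a _
    by_cases ha : a ∈ η
    · exact ⟨κ, hκ, fun y => by simp [ha]⟩
    · exact ⟨∅, hM.empty_mem, fun y => by simp [ha]⟩
  · exact fun z hz => ⟨{z}, hM.singleton_mem hz, fun _ => ZFSet.mem_singleton⟩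
  · intro a ha y
    rw [mem_shift]
    exact or_congr Iff.rfl ⟨fun ⟨z, hz, h⟩ => ⟨z, hBt a ha hz, hz, h⟩,
      fun ⟨z, _, hz, h⟩ => ⟨z, hz, h⟩⟩

theorem shift_mem (hM : IsTransitiveModelZF M) (hη : η ∈ M) (hκ : κ ∈ M) (hx : x ∈ M) :
    shift η κ x ∈ M := by
  obtain ⟨t, ht, hxt, htt, _⟩ := hM.exists_transitive_closure (hM.singleton_mem hx)
  exact (hM.shift_graph hη hκ ht htt).1 x (hxt (ZFSet.mem_singleton.2 rfl))

theorem shiftImage_mem (hM : IsTransitiveModelZF M) (hη : η ∈ M) (hκ : κ ∈ M) (hx : x ∈ M) :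
    shiftImage η κ x ∈ M := by
  obtain ⟨t, ht, hxt, htt, _⟩ := hM.exists_transitive_closure hx
  obtain ⟨hmem, g, hg, hg'⟩ := hM.shift_graph hη hκ ht htt
  have hgp : ∀ z ∈ x, ∀ y, ZFSet.pair z y ∈ g ↔ y = shift η κ z := by
    intro z hz y
    rw [hg']
    constructor
    · rintro ⟨w, _, he⟩
      obtain ⟨rfl, rfl⟩ := ZFSet.pair_injective he
      rfl
    · rintro rfl
      exact ⟨z, hxt hz, rfl⟩
  obtain ⟨i, hi, hi'⟩ := hM.exists_image (R := fun z y => ZFSet.pair z y ∈ g)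
    (.pairMem hM.transClass (.const (⟨g, hg⟩ : M)) (.var 0) (.var 1)) hx fun z hz =>
      ⟨_, ⟨hmem z (hxt hz), (hgp z hz _).2 rfl⟩, fun y hy => (hgp z hz y).1 hy.2⟩
  convert hi
  ext y
  rw [mem_shiftImage, hi']
  constructor
  · rintro ⟨z, hz, rfl⟩
    exact ⟨hmem z (hxt hz), z, hz, (hgp z hz _).2 rfl⟩
  · rintro ⟨_, z, hz, h⟩
    exact ⟨z, hz, (hgp z hz y).1 h⟩

theorem shiftSum_mem (hM : IsTransitiveModelZF M) (hη : η ∈ M) (hκ : κ ∈ M) :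
    shiftSum η κ ∈ M := hM.union_mem hκ (hM.shiftImage_mem hη hκ hη)

theorem flatPair_mem (hM : IsTransitiveModelZF M) (hη : η ∈ M) (hx : x ∈ M) (hy : y ∈ M) :
    flatPair η x y ∈ M :=
  have h0 := hM.singleton_mem hM.empty_mem
  hM.union_mem (hM.shiftImage_mem hη h0 hx) (hM.shiftImage_mem hη (hM.shiftSum_mem hη h0) hy)

theorem shift_mem_hier (hM : IsTransitiveModelZF M) (hη : η ∈ M) (hκ : κ ∈ M)
    (h : ∀ z ∈ η, shift η κ z ∈ κ') (hx : x ∈ hier M η α) : shift η κ x ∈ hier M κ' α := by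
  induction α using ZFSet.inductionOn generalizing x with
  | _ α ih =>
    by_cases hxη : x ∈ η
    · exact subset_hier (h x hxη)
    · obtain ⟨γ, hγ, hxγ, hxM⟩ := (mem_hier.1 hx).resolve_left hxη
      refine mem_hier.2 (.inr ⟨γ, hγ, fun y hy => ?_, hM.shift_mem hη hκ hxM⟩)
      obtain ⟨z, hz, rfl⟩ := (mem_shift.1 hy).resolve_left fun h => hxη h.1
      exact ih γ hγ (hxγ hz)

theorem flatPair_mem_hier (hM : IsTransitiveModelZF M) (hηM : η ∈ M) (hη : η.IsOrdinal)
    (hα : α.IsOrdinal) (h0 : ∅ ∈ α) (hxM : x ∈ M) (hyM : y ∈ M) (hx : x ∈ hier M η α)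
    (hy : y ∈ hier M η α) :
    flatPair η x y ∈ hier M (shiftSum η (shiftSum η {∅})) α := by
  have h1M := hM.singleton_mem hM.empty_mem
  have hκM := hM.shiftSum_mem hηM h1M
  have hlow : ∀ x ∈ hier M η α, ∃ γ ∈ α, x ⊆ hier M η γ := by
    intro x hx
    rcases mem_hier.1 hx with hx | ⟨γ, hγ, hx, _⟩
    · exact ⟨∅, h0, fun z hz => subset_hier (hη.mem_trans hz hx)⟩
    · exact ⟨γ, hγ, hx⟩
  obtain ⟨γ, hγ, hxγ, hyγ⟩ : ∃ γ ∈ α, x ⊆ hier M η γ ∧ y ⊆ hier M η γ := by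
    obtain ⟨γ, hγ, hxγ⟩ := hlow x hx
    obtain ⟨δ, hδ, hyδ⟩ := hlow y hy
    rcases (hα.mem hγ).subset_total (hα.mem hδ) with h | h
    · exact ⟨δ, hδ, fun z hz => hier_mono_right h (hxγ hz), hyδ⟩
    · exact ⟨γ, hγ, hxγ, fun z hz => hier_mono_right h (hyδ hz)⟩
  refine mem_hier.2 (.inr ⟨γ, hγ, fun z hz => ?_, hM.flatPair_mem hηM hxM hyM⟩)
  rcases mem_flatPair.1 hz with ⟨w, hw, rfl⟩ | ⟨w, hw, rfl⟩
  · exact hM.shift_mem_hier hηM h1M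
      (fun z hz => mem_shiftSum.2 (.inl (mem_shiftSum.2 (.inr ⟨z, hz, rfl⟩)))) (hxγ hw)
  · exact hM.shift_mem_hier hηM hκM
      (fun z hz => mem_shiftSum.2 (.inr ⟨z, hz, rfl⟩)) (hyγ hw)

theorem flatPair_graph (hM : IsTransitiveModelZF M) (hη : η ∈ M) {A : ZFSet.{u}} (hA : A ∈ M) :
    ∃ C ∈ M, ∀ p, p ∈ C ↔ ∃ x ∈ A, ∃ y ∈ A,
      p = ZFSet.pair (ZFSet.pair x y) (flatPair η x y) := by
  have hA' : ∀ {x}, x ∈ A → x ∈ M := fun h => hM.mem_of_mem hA h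
  obtain ⟨t, ht, hAt, htt, _⟩ := hM.exists_transitive_closure hA
  have h0 := hM.singleton_mem hM.empty_mem
  have hgp : ∀ κ ∈ M, ∃ g ∈ M, ∀ x ∈ A, ∀ w ∈ x, ∀ z, ZFSet.pair w z ∈ g ↔ z = shift η κ w := by
    intro κ hκ
    obtain ⟨_, g, hg, hg'⟩ := hM.shift_graph hη hκ ht htt
    refine ⟨g, hg, fun x hx w hw z => ?_⟩
    rw [hg']
    constructor
    · rintro ⟨v, _, he⟩
      obtain ⟨rfl, rfl⟩ := ZFSet.pair_injective he
      rfl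
    · rintro rfl
      exact ⟨w, htt x (hAt hx) hw, rfl⟩
  obtain ⟨g, hg, hg'⟩ := hgp _ h0
  obtain ⟨k, hk, hk'⟩ := hgp _ (hM.shiftSum_mem hη h0)
  have hval : ∀ x ∈ A, ∀ y ∈ A, ∀ v : M, (∀ z : M, (z : ZFSet) ∈ (v : ZFSet) ↔
      (∃ w : M, (w : ZFSet) ∈ x ∧ ZFSet.pair w z ∈ g) ∨
      ∃ w : M, (w : ZFSet) ∈ y ∧ ZFSet.pair w z ∈ k) ↔ (v : ZFSet) = flatPair η x y := by
    intro x hx y hy v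
    have hkey : ∀ z : ZFSet, ((∃ w : M, (w : ZFSet) ∈ x ∧ ZFSet.pair w z ∈ g) ∨
        ∃ w : M, (w : ZFSet) ∈ y ∧ ZFSet.pair w z ∈ k) ↔ z ∈ flatPair η x y := by
      intro z
      rw [mem_flatPair]
      refine or_congr ⟨?_, ?_⟩ ⟨?_, ?_⟩
      · exact fun ⟨w, hw, h⟩ => ⟨w, hw, (hg' x hx w hw z).1 h⟩
      · exact fun ⟨w, hw, h⟩ => ⟨⟨w, hM.mem_of_mem (hA' hx) hw⟩, hw, (hg' x hx w hw z).2 h⟩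
      · exact fun ⟨w, hw, h⟩ => ⟨w, hw, (hk' y hy w hw z).1 h⟩
      · exact fun ⟨w, hw, h⟩ => ⟨⟨w, hM.mem_of_mem (hA' hy) hw⟩, hw, (hk' y hy w hw z).2 h⟩
    simp only [hkey]
    constructor
    · intro h
      ext z
      exact ⟨fun hz => (h ⟨z, hM.mem_of_mem v.2 hz⟩).1 hz,
        fun hz => (h ⟨z, hM.mem_of_mem (hM.flatPair_mem hη (hA' hx) (hA' hy)) hz⟩).2 hz⟩
    · intro h z
      rw [h]
  obtain ⟨C, hC, hC'⟩ := hM.exists_image (R := fun q p => ∃ x y v : M, q = ZFSet.pair x y ∧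
      p = ZFSet.pair q v ∧ ∀ z : M, (z : ZFSet) ∈ (v : ZFSet) ↔
        (∃ w : M, (w : ZFSet) ∈ (x : ZFSet) ∧ ZFSet.pair w z ∈ g) ∨
        ∃ w : M, (w : ZFSet) ∈ (y : ZFSet) ∧ ZFSet.pair w z ∈ k)
    (.ex (.ex (.ex (.and (.eqPair hM.transClass (Trm.var 0).wk.wk.wk Trm.last.wk.wk Trm.last.wk)
      (.and (.eqPair hM.transClass (Trm.var 1).wk.wk.wk (Trm.var 0).wk.wk.wk .last)
        (.all (.iff (.coeMem .last Trm.last.wk)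
          (.or (.ex (.and (.coeMem .last Trm.last.wk.wk.wk.wk)
              (.pairMem hM.transClass (.const (⟨g, hg⟩ : M)) .last Trm.last.wk)))
            (.ex (.and (.coeMem .last Trm.last.wk.wk.wk)
              (.pairMem hM.transClass (.const (⟨k, hk⟩ : M)) .last Trm.last.wk)))))))))))
    (hM.prod_mem hA hA) (by
      intro q hq
      obtain ⟨x, hx, y, hy, rfl⟩ := ZFSet.mem_prod.1 hq
      have hf := hM.flatPair_mem hη (hA' hx) (hA' hy)
      refine ⟨_, ⟨hM.pair_mem (hM.pair_mem (hA' hx) (hA' hy)) hf, ⟨x, hA' hx⟩, ⟨y, hA' hy⟩,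
        ⟨_, hf⟩, rfl, rfl, (hval x hx y hy _).2 rfl⟩, ?_⟩
      rintro p ⟨_, x', y', v, hq, rfl, hv⟩
      obtain ⟨rfl, rfl⟩ := ZFSet.pair_injective hq
      rw [(hval _ hx _ hy v).1 hv])
  refine ⟨C, hC, fun p => ?_⟩
  rw [hC']
  constructor
  · rintro ⟨_, q, hq, x, y, v, rfl, rfl, hv⟩
    obtain ⟨hx, hy⟩ := ZFSet.pair_mem_prod.1 hq
    exact ⟨x, hx, y, hy, by rw [(hval _ hx _ hy v).1 hv]⟩
  · rintro ⟨x, hx, y, hy, rfl⟩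
    have hf := hM.flatPair_mem hη (hA' hx) (hA' hy)
    exact ⟨hM.pair_mem (hM.pair_mem (hA' hx) (hA' hy)) hf, _, ZFSet.pair_mem_prod.2 ⟨hx, hy⟩,
      ⟨x, hA' hx⟩, ⟨y, hA' hy⟩, ⟨_, hf⟩, rfl, rfl, (hval x hx y hy _).2 rfl⟩

end IsTransitiveModelZF

/-! ### Pairing of ordinals -/

/-- The lexicographic order on pairs, with the first coordinate dominant. -/
def LexLt (q p : ZFSet.{u}) : Prop :=
  ∃ a b c d, q = ZFSet.pair a b ∧ p = ZFSet.pair c d ∧ (a ∈ c ∨ a = c ∧ b ∈ d)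

theorem lexLt_pair {a b c d : ZFSet.{u}} :
    LexLt (ZFSet.pair a b) (ZFSet.pair c d) ↔ a ∈ c ∨ a = c ∧ b ∈ d := by
  constructor
  · rintro ⟨a', b', c', d', h1, h2, h⟩
    obtain ⟨rfl, rfl⟩ := ZFSet.pair_injective h1
    obtain ⟨rfl, rfl⟩ := ZFSet.pair_injective h2
    exact h
  · exact fun h => ⟨a, b, c, d, rfl, rfl, h⟩

theorem lexLt_wf : WellFounded LexLt.{u} := by
  have key : ∀ c d : ZFSet.{u}, Acc LexLt (ZFSet.pair c d) := by
    intro c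
    induction c using ZFSet.inductionOn with
    | _ c ihc =>
      intro d
      induction d using ZFSet.inductionOn with
      | _ d ihd =>
        refine ⟨_, ?_⟩
        rintro q ⟨a, b, c', d', rfl, he, h⟩
        obtain ⟨rfl, rfl⟩ := ZFSet.pair_injective he
        rcases h with h | ⟨rfl, h⟩
        · exact ihc a h b
        · exact ihd b h
  refine ⟨fun p => ⟨_, ?_⟩⟩
  rintro q ⟨a, b, _, _, rfl, _⟩
  exact key a b

theorem lexPred_wf (η : ZFSet.{u}) :
    WellFounded fun q p => q ∈ (ZFSet.prod η η).sep fun q => LexLt q p :=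
  Subrelation.wf (fun h => (ZFSet.mem_sep.1 h).2) lexLt_wf

/-- The position of a pair in the lexicographic order of `η × η`; for ordinals `a, b ∈ η` the value
at `(a, b)` is `η * a + b`. -/
noncomputable def lexCode (η : ZFSet.{u}) : ZFSet.{u} → ZFSet.{u} :=
  wfRec (fun p => (ZFSet.prod η η).sep fun q => LexLt q p) (fun _ => ∅) (fun z => {z})
    (lexPred_wf η)

theorem mem_lexCode {p : ZFSet.{u}} :
    y ∈ lexCode η p ↔ ∃ q ∈ ZFSet.prod η η, LexLt q p ∧ y = lexCode η q := by
  rw [lexCode, mem_wfRec]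
  simp [ZFSet.mem_sep, and_assoc]

theorem lexLt_trans (hη : η.IsOrdinal) {p q r : ZFSet.{u}} (hp : p ∈ ZFSet.prod η η)
    (hrq : LexLt r q) (hqp : LexLt q p) : LexLt r p := by
  obtain ⟨c, hc, d, hd, rfl⟩ := ZFSet.mem_prod.1 hp
  obtain ⟨a, b, c', d', rfl, he, hqp⟩ := hqp
  obtain ⟨rfl, rfl⟩ := ZFSet.pair_injective he
  obtain ⟨a', b', c', d', rfl, he, hrq⟩ := hrq
  obtain ⟨rfl, rfl⟩ := ZFSet.pair_injective he
  rw [lexLt_pair]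
  rcases hrq with hrq | ⟨rfl, hrq⟩ <;> rcases hqp with hqp | ⟨rfl, hqp⟩
  · exact .inl ((hη.mem hc).mem_trans hrq hqp)
  · exact .inl hrq
  · exact .inl hqp
  · exact .inr ⟨rfl, (hη.mem hd).mem_trans hrq hqp⟩

theorem lexCode_isTransitive (hη : η.IsOrdinal) {p : ZFSet.{u}} (hp : p ∈ ZFSet.prod η η) :
    (lexCode η p).IsTransitive := by
  intro y hy z hz
  obtain ⟨q, _, hqp, rfl⟩ := mem_lexCode.1 hy
  obtain ⟨r, hr, hrq, rfl⟩ := mem_lexCode.1 hz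
  exact mem_lexCode.2 ⟨r, hr, lexLt_trans hη hp hrq hqp, rfl⟩

theorem lexCode_injOn (hη : η.IsOrdinal) {p q : ZFSet.{u}} (hp : p ∈ ZFSet.prod η η)
    (hq : q ∈ ZFSet.prod η η) (h : lexCode η p = lexCode η q) : p = q := by
  have key : ∀ p q, p ∈ ZFSet.prod η η → LexLt p q → lexCode η p ≠ lexCode η q :=
    fun p q hp hpq h => ZFSet.mem_irrefl (lexCode η q) (mem_lexCode.2 ⟨p, hp, hpq, h.symm⟩)
  by_contra hne
  obtain ⟨a, ha, b, hb, rfl⟩ := ZFSet.mem_prod.1 hp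
  obtain ⟨c, hc, d, hd, rfl⟩ := ZFSet.mem_prod.1 hq
  have h1 := fun h' => key _ _ hp (lexLt_pair.2 h') h
  have h2 := fun h' => key _ _ hq (lexLt_pair.2 h') h.symm
  rcases (hη.mem ha).mem_trichotomous (hη.mem hc) with hac | rfl | hac
  · exact h1 (.inl hac)
  · rcases (hη.mem hb).mem_trichotomous (hη.mem hd) with hbd | rfl | hbd
    · exact h1 (.inr ⟨rfl, hbd⟩)
    · exact hne rfl
    · exact h2 (.inr ⟨rfl, hbd⟩)
  · exact h2 (.inl hac)

namespace IsTransitiveModelZF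

theorem lexCode_graph (hM : IsTransitiveModelZF M) (hη : η ∈ M) :
    (∀ p ∈ ZFSet.prod η η, lexCode η p ∈ M) ∧
      ∃ g ∈ M, ∀ q, q ∈ g ↔ ∃ p ∈ ZFSet.prod η η, q = ZFSet.pair p (lexCode η p) := by
  refine hM.exists_recursion (K := fun _ _ => False) (R := LexLt)
    (Q := fun z y => y = z) (hM.prod_mem hη hη) .false ?_ (.coeEq (.var 1) (.var 0)) ?_ ?_ ?_ _ ?_
  · refine Dfn.congr (P := fun v : Fin 2 → M => ∃ a b c d : M, (v 0 : ZFSet) = ZFSet.pair a b ∧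
      (v 1 : ZFSet) = ZFSet.pair c d ∧
      ((a : ZFSet) ∈ (c : ZFSet) ∨ (a : ZFSet) = c ∧ (b : ZFSet) ∈ (d : ZFSet)))
      (.ex (.ex (.ex (.ex (.and (.eqPair hM.transClass (Trm.var 0).wk.wk.wk.wk Trm.last.wk.wk.wk
        Trm.last.wk.wk) (.and (.eqPair hM.transClass (Trm.var 1).wk.wk.wk.wk Trm.last.wk .last)
        (.or (.coeMem Trm.last.wk.wk.wk Trm.last.wk) (.and (.coeEq Trm.last.wk.wk.wk Trm.last.wk)
          (.coeMem Trm.last.wk.wk .last))))))))) fun v => ⟨?_, ?_⟩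
    · rintro ⟨a, b, c, d, h1, h2, h⟩
      have hab := hM.mem_of_pair_mem (h1 ▸ (v 0).2)
      have hcd := hM.mem_of_pair_mem (h2 ▸ (v 1).2)
      exact ⟨⟨a, hab.1⟩, ⟨b, hab.2⟩, ⟨c, hcd.1⟩, ⟨d, hcd.2⟩, h1, h2, h⟩
    · exact fun ⟨a, b, c, d, h⟩ => ⟨a, b, c, d, h⟩
  · exact Subrelation.wf (fun h => h.2.2) lexLt_wf
  · exact fun _ _ => ⟨∅, hM.empty_mem, fun y => by simp⟩
  · exact fun z hz => ⟨{z}, hM.singleton_mem hz, fun _ => ZFSet.mem_singleton⟩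
  · intro a _ y
    rw [mem_lexCode, false_or]

/-- The set of all lexicographic positions in `η × η` is an ordinal of `M`. -/
theorem exists_lexCode_bound (hM : IsTransitiveModelZF M) (hηM : η ∈ M) (hη : η.IsOrdinal) :
    ∃ θ ∈ M, θ.IsOrdinal ∧ ∀ p ∈ ZFSet.prod η η, lexCode η p ∈ θ := by
  obtain ⟨hmem, g, hg, hg'⟩ := hM.lexCode_graph hηM
  have hgp : ∀ p ∈ ZFSet.prod η η, ∀ y, ZFSet.pair p y ∈ g ↔ y = lexCode η p := by
    intro p hp y
    rw [hg']
    constructor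
    · rintro ⟨q, _, he⟩
      obtain ⟨rfl, rfl⟩ := ZFSet.pair_injective he
      rfl
    · rintro rfl
      exact ⟨p, hp, rfl⟩
  obtain ⟨θ, hθ, hθ'⟩ := hM.exists_image (R := fun z y => ZFSet.pair z y ∈ g)
    (.pairMem hM.transClass (.const (⟨g, hg⟩ : M)) (.var 0) (.var 1)) (hM.prod_mem hηM hηM)
    fun p hp => ⟨_, ⟨hmem p hp, (hgp p hp _).2 rfl⟩, fun y hy => (hgp p hp y).1 hy.2⟩
  have hθm : ∀ p ∈ ZFSet.prod η η, lexCode η p ∈ θ := fun p hp =>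
    (hθ' _).2 ⟨hmem p hp, p, hp, (hgp p hp _).2 rfl⟩
  refine ⟨θ, hθ, ?_, hθm⟩
  rw [ZFSet.isOrdinal_iff_forall_mem_isTransitive]
  constructor
  · intro y hy z hz
    obtain ⟨_, p, hp, h⟩ := (hθ' y).1 hy
    rw [(hgp p hp y).1 h] at hz
    obtain ⟨q, hq, _, rfl⟩ := mem_lexCode.1 hz
    exact hθm q hq
  · intro y hy
    obtain ⟨_, p, hp, h⟩ := (hθ' y).1 hy
    rw [(hgp p hp y).1 h]
    exact lexCode_isTransitive hη hp

end IsTransitiveModelZF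

variable {M N : Set ZFSet.{u}} {α : Ordinal.{u}} {x y : ZFSet.{u}}

/-! ### Transfer of relations between models with the same sets of ordinals -/

theorem IsTransitiveModelZF.subset_mem_alphaSets (hM : IsTransitiveModelZF M)
    (hx : x ∈ alphaSets M α) (hy : y ∈ M) (hyx : y ⊆ x) : y ∈ alphaSets M α := by
  rw [hM.mem_alphaSets_iff] at hx ⊢
  obtain ⟨hα, _, η, hηM, hη, hx⟩ := hx
  exact ⟨hα, hy, η, hηM, hη, fun z hz => hx (hyx hz)⟩

theorem IsTransitiveModelZF.isOrdinal_mem_alphaSets (hM : IsTransitiveModelZF M)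
    (hα : α.toZFSet ∈ M) (hx : x ∈ M) (hxo : x.IsOrdinal) : x ∈ alphaSets M α :=
  hM.mem_alphaSets_iff.2 ⟨hα, hx, x, hx, hxo, subset_hier⟩

/-- Pairs of elements of an `α`-set can be coded by elements of some iterated power set
`𝒫^α(η')`, by means of a function that belongs to both models. -/
theorem exists_pairing (hM : IsTransitiveModelZF M) (hN : IsTransitiveModelZF N)
    (hα : α.toZFSet ∈ M) (hsame : alphaSets M α = alphaSets N α) {A : ZFSet.{u}}
    (hA : A ∈ alphaSets M α) :
    ∃ η' ∈ M, η'.IsOrdinal ∧ ∃ C ∈ M, C ∈ N ∧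
      (∀ x ∈ A, ∀ y ∈ A, ∃ v, ZFSet.pair (ZFSet.pair x y) v ∈ C) ∧
      (∀ p q v, ZFSet.pair p v ∈ C → ZFSet.pair q v ∈ C → p = q) ∧
      ∀ p v, ZFSet.pair p v ∈ C → v ∈ hier M η' α.toZFSet := by
  have hto : ∀ {x}, x ∈ alphaSets M α → x ∈ N := fun h => by
    rw [hsame] at h
    exact h.2.1
  have hAN := hto hA
  obtain ⟨-, hAM, η, hηM, hη, hAη⟩ := hM.mem_alphaSets_iff.1 hA
  rcases eq_or_ne α 0 with rfl | hα0
  · rw [Ordinal.toZFSet_zero, hier_empty] at hAη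
    have hηN := hto (hM.isOrdinal_mem_alphaSets hα hηM hη)
    obtain ⟨θ, hθM, hθ, hθm⟩ := hM.exists_lexCode_bound hηM hη
    obtain ⟨_, C, hC, hC'⟩ := hM.lexCode_graph hηM
    obtain ⟨_, D, hD, hD'⟩ := hN.lexCode_graph hηN
    obtain rfl : C = D := by
      ext p
      rw [hC', hD']
    have hCp : ∀ p v, ZFSet.pair p v ∈ C → p ∈ ZFSet.prod η η ∧ v = lexCode η p := by
      intro p v h
      obtain ⟨q, hq, he⟩ := (hC' _).1 h
      obtain ⟨rfl, rfl⟩ := ZFSet.pair_injective he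
      exact ⟨hq, rfl⟩
    refine ⟨θ, hθM, hθ, C, hC, hD, fun x hx y hy => ⟨_, (hC' _).2 ⟨_, ?_, rfl⟩⟩, ?_, ?_⟩
    · exact ZFSet.pair_mem_prod.2 ⟨hAη hx, hAη hy⟩
    · intro p q v hp hq
      obtain ⟨hp', rfl⟩ := hCp _ _ hp
      obtain ⟨hq', he⟩ := hCp _ _ hq
      exact lexCode_injOn hη hp' hq' he
    · intro p v hp
      obtain ⟨hp', rfl⟩ := hCp _ _ hp
      rw [Ordinal.toZFSet_zero, hier_empty]
      exact hθm p hp'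
  · -- the shifts need a nonempty base
    obtain ⟨η, hηM, hη, h0, hAη⟩ : ∃ η ∈ M, η.IsOrdinal ∧ ∅ ∈ η ∧ A ⊆ hier M η α.toZFSet := by
      refine ⟨insert η η, hM.insert_mem hηM hηM, ZFSet.isOrdinal_succ hη, ?_,
        fun x hx => hier_mono_left (fun z hz => ZFSet.mem_insert_of_mem _ hz) (hAη hx)⟩
      obtain rfl | ⟨z, hz⟩ := ZFSet.eq_empty_or_nonempty η
      · exact ZFSet.mem_insert _ _
      · exact (ZFSet.isOrdinal_empty.mem_of_subset_of_mem (ZFSet.isOrdinal_succ hη)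
          (ZFSet.empty_subset η) (ZFSet.mem_insert _ _))
    have hηN := hto (hM.isOrdinal_mem_alphaSets hα hηM hη)
    have h0α : ∅ ∈ α.toZFSet := by
      rw [← Ordinal.toZFSet_zero, Ordinal.toZFSet_mem_toZFSet_iff]
      exact pos_iff_ne_zero.2 hα0
    have h1M := hM.singleton_mem hM.empty_mem
    obtain ⟨C, hC, hC'⟩ := hM.flatPair_graph hηM hAM
    obtain ⟨D, hD, hD'⟩ := hN.flatPair_graph hηN hAN
    obtain rfl : C = D := by
      ext p
      rw [hC', hD']
    refine ⟨_, hM.shiftSum_mem hηM (hM.shiftSum_mem hηM h1M),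
      shiftSum_isOrdinal hη (shiftSum_isOrdinal hη singleton_empty_isOrdinal), C, hC, hD,
      fun x hx y hy => ⟨_, (hC' _).2 ⟨x, hx, y, hy, rfl⟩⟩, ?_, ?_⟩
    · intro p q v hp hq
      obtain ⟨x, _, y, _, he⟩ := (hC' _).1 hp
      obtain ⟨rfl, rfl⟩ := ZFSet.pair_injective he
      obtain ⟨x', _, y', _, he⟩ := (hC' _).1 hq
      obtain ⟨rfl, he'⟩ := ZFSet.pair_injective he
      obtain ⟨rfl, rfl⟩ := flatPair_inj hη.isTransitive h0 he'
      rfl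
    · intro p v hp
      obtain ⟨x, hx, y, hy, he⟩ := (hC' _).1 hp
      obtain ⟨rfl, rfl⟩ := ZFSet.pair_injective he
      exact hM.flatPair_mem_hier hηM hη (ZFSet.isOrdinal_toZFSet α) h0α
        (hM.mem_of_mem hAM hx) (hM.mem_of_mem hAM hy) (hAη hx) (hAη hy)

/-- A binary relation in `M` on an `α`-set is in `N`, since its set of codes is an `α`-set. -/
theorem relation_mem (hM : IsTransitiveModelZF M) (hN : IsTransitiveModelZF N)
    (hα : α.toZFSet ∈ M) (hsame : alphaSets M α = alphaSets N α) {A E : ZFSet.{u}}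
    (hA : A ∈ alphaSets M α) (hE : E ∈ M) (hEA : E ⊆ ZFSet.prod A A) : E ∈ N := by
  obtain ⟨η', hη'M, hη', C, hC, hCN, hdom, hinj, hran⟩ := exists_pairing hM hN hα hsame hA
  have hH := hM.hier_mem hη'M hα (ZFSet.isOrdinal_toZFSet α)
  have hcode := hM.sep_mem (P := fun v => ∃ p : M, (p : ZFSet) ∈ E ∧ ZFSet.pair p v ∈ C)
    (.ex (.and (.coeMem .last (.const (⟨E, hE⟩ : M)))
      (.pairMem hM.transClass (.const (⟨C, hC⟩ : M)) .last (Trm.var 0).wk))) hH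
  have hc : (hier M η' α.toZFSet).sep (fun v => ∃ p : M, (p : ZFSet) ∈ E ∧ ZFSet.pair p v ∈ C) ∈
      alphaSets M α :=
    hM.mem_alphaSets_iff.2 ⟨hα, hcode, η', hη'M, hη', ZFSet.sep_subset⟩
  generalize hc' : (hier M η' α.toZFSet).sep
    (fun v => ∃ p : M, (p : ZFSet) ∈ E ∧ ZFSet.pair p v ∈ C) = c at hc
  have hcN : c ∈ N := by
    rw [hsame] at hc
    exact hc.2.1
  have hAN : A ∈ N := by
    rw [hsame] at hA
    exact hA.2.1
  have hEN := hN.sep_mem (P := fun p => ∃ v : N, (v : ZFSet) ∈ c ∧ ZFSet.pair p v ∈ C)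
    (.ex (.and (.coeMem .last (.const (⟨c, hcN⟩ : N)))
      (.pairMem hN.transClass (.const (⟨C, hCN⟩ : N)) (Trm.var 0).wk .last))) (hN.prod_mem hAN hAN)
  convert hEN
  ext p
  rw [ZFSet.mem_sep]
  constructor
  · intro hp
    obtain ⟨x, hx, y, hy, rfl⟩ := ZFSet.mem_prod.1 (hEA hp)
    obtain ⟨v, hv⟩ := hdom x hx y hy
    have hvc : v ∈ c := by
      rw [← hc', ZFSet.mem_sep]
      exact ⟨hran _ _ hv, ⟨_, hM.mem_of_mem hE hp⟩, hp, hv⟩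
    exact ⟨hEA hp, ⟨v, hN.mem_of_mem hcN hvc⟩, hvc, hv⟩
  · rintro ⟨_, v, hvc, hv⟩
    rw [← hc', ZFSet.mem_sep] at hvc
    obtain ⟨_, q, hq, hqv⟩ := hvc
    rwa [hinj _ _ _ hv hqv]

/-! ### Equality of the models -/

/-- Mostowski collapse: a transitive set whose membership relation has an isomorphic copy in `N`
is a subset of `N`. -/
theorem IsTransitiveModelZF.subset_of_copy (hN : IsTransitiveModelZF N) {T A E : ZFSet.{u}}
    (hT : T.IsTransitive) (f : ZFSet.{u} → ZFSet.{u})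
    (hf : ∀ s ∈ T, ∀ t ∈ T, f s = f t → s = t) (hA : A ∈ N) (hE : E ∈ N)
    (hA' : ∀ a, a ∈ A ↔ ∃ t ∈ T, f t = a)
    (hE' : ∀ s ∈ T, ∀ t ∈ T, ZFSet.pair (f s) (f t) ∈ E ↔ s ∈ t) : ∀ t ∈ T, t ∈ N := by
  have hinv : ∃ g : ZFSet.{u} → ZFSet.{u}, ∀ t ∈ T, g (f t) = t := by
    classical
    refine ⟨fun a => if h : ∃ t ∈ T, f t = a then h.choose else ∅, fun t ht => ?_⟩
    have h : ∃ s ∈ T, f s = f t := ⟨t, ht, rfl⟩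
    simp only [h, dif_pos]
    exact hf _ h.choose_spec.1 _ ht h.choose_spec.2
  obtain ⟨g, hg⟩ := hinv
  have hrec := hN.exists_recursion (K := fun _ _ => False)
    (R := fun b a => ZFSet.pair b a ∈ E) (Q := fun z y => y = z) hA .false
    (.pairMem hN.transClass (.const (⟨E, hE⟩ : N)) (.var 0) (.var 1)) (.coeEq (.var 1) (.var 0))
    (by
      refine Subrelation.wf ?_ (InvImage.wf g ZFSet.mem_wf)
      rintro b a ⟨hb, ha, hba⟩
      obtain ⟨s, hs, rfl⟩ := (hA' b).1 hb
      obtain ⟨t, ht, rfl⟩ := (hA' a).1 ha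
      rw [hE' s hs t ht] at hba
      simpa only [InvImage, hg s hs, hg t ht] using hba)
    (fun _ _ => ⟨∅, hN.empty_mem, fun y => by simp⟩)
    (fun z hz => ⟨{z}, hN.singleton_mem hz, fun _ => ZFSet.mem_singleton⟩) g (by
      intro a ha y
      obtain ⟨t, ht, rfl⟩ := (hA' a).1 ha
      rw [hg t ht, false_or]
      constructor
      · intro hy
        have hyT := hT t ht hy
        exact ⟨f y, (hA' _).2 ⟨y, hyT, rfl⟩, (hE' y hyT t ht).2 hy, (hg y hyT).symm⟩
      · rintro ⟨b, hb, hbt, rfl⟩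
        obtain ⟨s, hs, rfl⟩ := (hA' b).1 hb
        rw [hg s hs]
        exact (hE' s hs t ht).1 hbt)
  intro t ht
  rw [← hg t ht]
  exact hrec.1 _ ((hA' _).2 ⟨t, ht, rfl⟩)

/-- The principle `KWP_α` in a transitive model, with the bijection given as a function on sets. -/
theorem IsTransitiveModelZF.exists_bijection (hM : IsTransitiveModelZF M) (hα : α.toZFSet ∈ M)
    (hKWP : KWP (⟨α.toZFSet, hα⟩ : M)) (hx : x ∈ M) :
    ∃ A ∈ alphaSets M α, ∃ g ∈ M, ∃ f : ZFSet.{u} → ZFSet.{u},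
      (∀ s ∈ x, ∀ v, ZFSet.pair s v ∈ g ↔ v = f s) ∧ (∀ s ∈ x, ∀ t ∈ x, f s = f t → s = t) ∧
      ∀ a, a ∈ A ↔ ∃ s ∈ x, f s = a := by
  obtain ⟨A, hA, g, hg1, hg2, hg3⟩ := hKWP ⟨x, hx⟩
  have hT := hM.transClass
  have hex : ∀ s ∈ x, ∃ a ∈ (A : ZFSet), ∀ v, ZFSet.pair s v ∈ (g : ZFSet) ↔ v = a := by
    intro s hs
    obtain ⟨a, ha, hu⟩ := hg2 ⟨s, hM.mem_of_mem hx hs⟩ hs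
    rw [hT.maps_iff] at ha
    have haA : (a : ZFSet) ∈ (A : ZFSet) := by
      obtain ⟨s', a', _, ha', he⟩ := hg1 ⟨_, hM.mem_of_mem g.2 ha⟩ ha
      rw [hT.isOPair_iff] at he
      rw [(ZFSet.pair_injective he).2]
      exact ha'
    refine ⟨a, haA, fun v => ⟨fun hv => ?_, fun hv => hv ▸ ha⟩⟩
    have hvM := (hM.mem_of_pair_mem (hM.mem_of_mem g.2 hv)).2
    exact congrArg Subtype.val (hu ⟨v, hvM⟩ (hT.maps_iff.2 hv))
  choose! f hfA hf using hex
  refine ⟨A, ⟨hα, A.2, hA⟩, g, g.2, f, hf, ?_, fun a => ⟨fun ha => ?_, ?_⟩⟩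
  · intro s hs t ht he
    obtain ⟨w, _, hu⟩ := hg3 ⟨f s, hM.mem_of_mem A.2 (hfA s hs)⟩ (hfA s hs)
    have h1 := hu ⟨s, hM.mem_of_mem hx hs⟩ (hT.maps_iff.2 ((hf s hs _).2 rfl))
    have h2 := hu ⟨t, hM.mem_of_mem hx ht⟩ (hT.maps_iff.2 ((hf t ht _).2 he))
    exact congrArg Subtype.val (h1.trans h2.symm)
  · obtain ⟨s, hs, _⟩ := hg3 ⟨a, hM.mem_of_mem A.2 ha⟩ ha
    rw [hT.maps_iff] at hs
    have hsx : (s : ZFSet) ∈ x := by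
      obtain ⟨s', a', hs', _, he⟩ := hg1 ⟨_, hM.mem_of_mem g.2 hs⟩ hs
      rw [hT.isOPair_iff] at he
      rw [(ZFSet.pair_injective he).1]
      exact hs'
    exact ⟨s, hsx, ((hf s hsx a).1 hs).symm⟩
  · rintro ⟨s, hs, rfl⟩
    exact hfA s hs

theorem model_subset (hM : IsTransitiveModelZF M) (hN : IsTransitiveModelZF N)
    (hα : α.toZFSet ∈ M) (hsame : alphaSets M α = alphaSets N α)
    (hKWP : KWP (⟨α.toZFSet, hα⟩ : M)) : M ⊆ N := by
  intro x hx
  obtain ⟨T, hTM, hxT, hT, _⟩ := hM.exists_transitive_closure (hM.singleton_mem hx)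
  obtain ⟨A, hA, g, hg, f, hgf, hf, hA'⟩ := hM.exists_bijection hα hKWP hTM
  have hAM := hA.2.1
  have hfM : ∀ s ∈ T, f s ∈ M := fun s hs => hM.mem_of_mem hAM ((hA' _).2 ⟨s, hs, rfl⟩)
  -- the copy of the membership relation of `T` on the `α`-set `A`
  have hEM := hM.sep_mem (P := fun p => ∃ s t a b : M, ((s : ZFSet) ∈ T ∧ (t : ZFSet) ∈ T ∧
      (s : ZFSet) ∈ (t : ZFSet)) ∧ ZFSet.pair s a ∈ g ∧ ZFSet.pair t b ∈ g ∧ p = ZFSet.pair a b)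
    (.ex (.ex (.ex (.ex (.and (.and (.coeMem Trm.last.wk.wk.wk (.const (⟨T, hTM⟩ : M)))
      (.and (.coeMem Trm.last.wk.wk (.const (⟨T, hTM⟩ : M)))
        (.coeMem Trm.last.wk.wk.wk Trm.last.wk.wk)))
      (.and (.pairMem hM.transClass (.const (⟨g, hg⟩ : M)) Trm.last.wk.wk.wk Trm.last.wk)
        (.and (.pairMem hM.transClass (.const (⟨g, hg⟩ : M)) Trm.last.wk.wk .last)
          (.eqPair hM.transClass (Trm.var 0).wk.wk.wk.wk Trm.last.wk .last))))))))
    (hM.prod_mem hAM hAM)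
  have hEN := relation_mem hM hN hα hsame hA hEM ZFSet.sep_subset
  have hAN : A ∈ N := by
    rw [hsame] at hA
    exact hA.2.1
  refine hN.subset_of_copy hT f hf hAN hEN hA' (fun s hs t ht => ?_) x
    (hxT (ZFSet.mem_singleton.2 rfl))
  rw [ZFSet.mem_sep]
  constructor
  · rintro ⟨_, s', t', a, b, ⟨hs', ht', hst⟩, hsa, htb, he⟩
    rw [hgf _ hs'] at hsa
    rw [hgf _ ht'] at htb
    obtain ⟨h1, h2⟩ := ZFSet.pair_injective he
    rw [hf s hs _ hs' (h1.trans hsa), hf t ht _ ht' (h2.trans htb)]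
    exact hst
  · intro hst
    exact ⟨ZFSet.pair_mem_prod.2 ⟨(hA' _).2 ⟨s, hs, rfl⟩, (hA' _).2 ⟨t, ht, rfl⟩⟩,
      ⟨s, hM.mem_of_mem hTM hs⟩, ⟨t, hM.mem_of_mem hTM ht⟩, ⟨_, hfM s hs⟩, ⟨_, hfM t ht⟩,
      ⟨hs, ht, hst⟩, (hgf s hs _).2 rfl, (hgf t ht _).2 rfl, rfl⟩

theorem mem_toZFSet_rank : y ∈ x.rank.toZFSet ↔
    ∃ z ∈ x, y = z.rank.toZFSet ∨ y ∈ z.rank.toZFSet := by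
  rw [Ordinal.mem_toZFSet_iff]
  constructor
  · rintro ⟨a, ha, rfl⟩
    obtain ⟨z, hz, haz⟩ := ZFSet.lt_rank_iff.1 ha
    refine ⟨z, hz, ?_⟩
    rw [Ordinal.toZFSet_mem_toZFSet_iff]
    exact haz.eq_or_lt.imp (congrArg _) id
  · rintro ⟨z, hz, rfl | hy⟩
    · exact ⟨_, ZFSet.rank_lt_of_mem hz, rfl⟩
    · obtain ⟨a, ha, rfl⟩ := Ordinal.mem_toZFSet_iff.1 hy
      exact ⟨a, ha.trans (ZFSet.rank_lt_of_mem hz), rfl⟩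

theorem IsTransitiveModelZF.rank_mem (hN : IsTransitiveModelZF N) (hx : x ∈ N) :
    x.rank.toZFSet ∈ N := by
  obtain ⟨T, hTN, hxT, hT, _⟩ := hN.exists_transitive_closure (hN.singleton_mem hx)
  refine (hN.exists_recursion (K := fun _ _ => False) (R := fun b a => b ∈ a)
    (Q := fun z y => y = z ∨ y ∈ z) hTN .false (.coeMem (.var 0) (.var 1))
    (.or (.coeEq (.var 1) (.var 0)) (.coeMem (.var 1) (.var 0)))
    (Subrelation.wf (fun h => h.2.2) ZFSet.mem_wf)
    (fun _ _ => ⟨∅, hN.empty_mem, fun y => by simp⟩)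
    (fun z hz => ⟨_, hN.insert_mem hz hz, fun y => ZFSet.mem_insert_iff⟩)
    (fun x => x.rank.toZFSet) fun a ha y => ?_).1 x (hxT (ZFSet.mem_singleton.2 rfl))
  rw [mem_toZFSet_rank, false_or]
  exact ⟨fun ⟨z, hz, h⟩ => ⟨z, hT a ha hz, hz, h⟩, fun ⟨z, _, hz, h⟩ => ⟨z, hz, h⟩⟩

/-- With the base `∅`, the iterated power sets form the von Neumann hierarchy of `M`. -/
theorem subset_hier_rank (hM : TransClass M) (hx : ∀ y ∈ x, y ∈ M) :
    x ⊆ hier M ∅ x.rank.toZFSet := by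
  induction x using ZFSet.inductionOn with
  | _ x ih =>
    intro y hy
    refine mem_hier.2 (.inr ⟨y.rank.toZFSet, ?_, ih y hy fun z hz => hM _ (hx y hy) _ hz, hx y hy⟩)
    rw [Ordinal.toZFSet_mem_toZFSet_iff]
    exact ZFSet.rank_lt_of_mem hy

theorem model_superset (hM : IsTransitiveModelZF M) (hN : IsTransitiveModelZF N)
    (hα : α.toZFSet ∈ M) (hsame : alphaSets M α = alphaSets N α)
    (hKWP : KWP (⟨α.toZFSet, hα⟩ : M)) : N ⊆ M := by
  have hsub := model_subset hM hN hα hsame hKWP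
  intro x
  induction x using ZFSet.inductionOn with
  | _ x ih =>
    intro hxN
    have hxM : ∀ y ∈ x, y ∈ M := fun y hy => ih y hy (hN.mem_of_mem hxN hy)
    have hrM : x.rank.toZFSet ∈ M := by
      have h := hN.isOrdinal_mem_alphaSets (hsub hα) (hN.rank_mem hxN) (ZFSet.isOrdinal_toZFSet _)
      rw [← hsame] at h
      exact h.2.1
    have hB := hM.hier_mem hM.empty_mem hrM (ZFSet.isOrdinal_toZFSet _)
    have hxB := subset_hier_rank hM.transClass hxM
    generalize hier M ∅ x.rank.toZFSet = B at hB hxB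
    obtain ⟨A, hA, g, hg, f, hgf, hf, hA'⟩ := hM.exists_bijection hα hKWP hB
    have hAN := hsub hA.2.1
    -- the image of `x` in the `α`-set `A`
    have hI := hN.sep_mem (P := fun a => ∃ s : N, (s : ZFSet) ∈ x ∧ ZFSet.pair s a ∈ g)
      (.ex (.and (.coeMem .last (.const (⟨x, hxN⟩ : N)))
        (.pairMem hN.transClass (.const (⟨g, hsub hg⟩ : N)) .last (Trm.var 0).wk))) hAN
    have hIM : A.sep (fun a => ∃ s : N, (s : ZFSet) ∈ x ∧ ZFSet.pair s a ∈ g) ∈ M := by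
      have h := hN.subset_mem_alphaSets (hsame ▸ hA) hI ZFSet.sep_subset
      rw [← hsame] at h
      exact h.2.1
    generalize hI' : A.sep (fun a => ∃ s : N, (s : ZFSet) ∈ x ∧ ZFSet.pair s a ∈ g) = I at hIM
    have hx' := hM.sep_mem (P := fun s => ∃ a : M, (a : ZFSet) ∈ I ∧ ZFSet.pair s a ∈ g)
      (.ex (.and (.coeMem .last (.const (⟨I, hIM⟩ : M)))
        (.pairMem hM.transClass (.const (⟨g, hg⟩ : M)) (Trm.var 0).wk .last))) hB
    convert hx'
    ext s
    rw [ZFSet.mem_sep]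
    constructor
    · intro hs
      have hsB := hxB hs
      have hfA : f s ∈ A := (hA' _).2 ⟨s, hsB, rfl⟩
      refine ⟨hsB, ⟨f s, hM.mem_of_mem hA.2.1 hfA⟩, ?_, (hgf s hsB _).2 rfl⟩
      rw [← hI', ZFSet.mem_sep]
      exact ⟨hfA, ⟨s, hsub (hxM s hs)⟩, hs, (hgf s hsB _).2 rfl⟩
    · rintro ⟨hsB, a, ha, hsa⟩
      rw [← hI', ZFSet.mem_sep] at ha
      obtain ⟨_, t, ht, hta⟩ := ha
      rw [hgf s hsB] at hsa
      rw [hgf t (hxB ht)] at hta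
      rwa [hf s hsB t (hxB ht) (hsa.symm.trans hta)]

end SetModel

theorem mainTheorem6 (M N : Set ZFSet.{u})
    (hM : SetModel.IsTransitiveModelZF M) (hN : SetModel.IsTransitiveModelZF N)
    (α : Ordinal.{u}) (hα : α.toZFSet ∈ M)
    (hsame : SetModel.alphaSets M α = SetModel.alphaSets N α)
    (hKWP : SetModel.KWP (⟨α.toZFSet, hα⟩ : M)) :
    M = N :=
  Set.Subset.antisymm (SetModel.model_subset hM hN hα hsame hKWP)
    (SetModel.model_superset hM hN hα hsame hKWP)
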